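/- Let $1<\sigma<2$, let $p(r)=(r^2+r^{2-\sigma})^{1/2}$ for $r\ge 0$, and let $r_0=\left(\frac{2-\sigma}{2(\sigma-1)}\right)^{1/\sigma}$ (the point where $p''(r_0)=0$). For a function $m$ on $\mathbb R^3$ let the Fourier multiplier with symbol $m$ be $f\mapsto\mathcal F^{-1}(m\,\mathcal F f)$, where $\mathcal Ff(\xi)=\int_{\mathbb R^3}e^{-ix\cdot\xi}f(x)\,dx$, and let $e^{itp(|\nabla|)}$ be the multiplier with symbol $e^{itp(|\xi|)}$. Let $\varepsilon>0$ with $2\varepsilon<r_0$, let $\Psi_{r_0}:\mathbb R^3\to[0,1]$ be smooth and radial with $\Psi_{r_0}(\xi)=1$ if $\big||\xi|-r_0\big|\le\varepsilon$ and $\Psi_{r_0}(\xi)=0$ if $\big||\xi|-r_0\big|>2\varepsilon$, and let $Q_{r_0}$ be the multiplier with symbol $\Psi_{r_0}$. Then there is a constant $C>0$, depending only on $\sigma,\varepsilon,\Psi_{r_0}$, such that for all real $t\ne0$ and all $f\in L^1(\mathbb R^3;\mathbb C)$ $$\|e^{itp(|\nabla|)}Q_{r_0}f\|_{L^\infty}\le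 C|t|^{-4/3}\|f\|_{L^1}.$$ Moreover, let $\psi:\mathbb R^3\to[0,1]$ be smooth and radial, supported in $\{|\xi|\le2\}$, with $\psi(\xi)=1$ for $|\xi|\le1$, and let $P_N$ be the multiplier with symbol $\psi(\xi/N)-\psi(2\xi/N)$. Then there is a constant $C>0$, depending only on $\sigma,\varepsilon,\Psi_{r_0},\psi$, such that for all real $t\ne0$, all dyadic $N=2^k$, $k\in\mathbb Z$, and all $f\in L^1(\mathbb R^3;\mathbb C)$ $$\|e^{itp(|\nabla|)}P_N(1-Q_{r_0})f\|_{L^\infty}\le C|t|^{-3/2}N^{17/6}\|f\|_{L^1}\quad\text{if }N\ge1,$$ $$\|e^{itp(|\nabla|)}P_N(1-Q_{r_0})f\|_{L^\infty}\le C|t|^{-3/2}N^{\frac32+\frac{3\sigma}4}\|f\|_{L^1}\quad\text{if }N<1.$$ -/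

import Mathlib

open MeasureTheory
open scoped FourierTransform ContDiff ENNReal

noncomputable section

/-- Three-dimensional Euclidean space. -/
abbrev R3 : Type := EuclideanSpace ℝ (Fin 3)

/-- The Fourier multiplier operator `f ↦ ℱ⁻¹(m ℱ f)`. The symbol `m` is a function of the angular
frequency `ξ`, i.e. it refers to the transform with kernel `exp (-i x · ξ)`, for which `|∇|` has
symbol `|ξ|`. Mathlib's `𝓕` has the kernel `exp (-2 π i x · y)`, so that `ξ = 2 π y`. -/
def fourierMultiplier (m : R3 → ℂ) (f : R3 → ℂ) : R3 → ℂ :=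
  𝓕⁻ (fun y : R3 => m ((2 * Real.pi) • y) * 𝓕 f y)

/-- The dispersion relation `p(r) = (r² + r^(2-σ))^(1/2)`. -/
def dispersion (σ r : ℝ) : ℝ := Real.sqrt (r ^ 2 + r ^ (2 - σ))

/-- The degenerate point `r₀ = ((2-σ) / (2(σ-1)))^(1/σ)` of the dispersion relation. -/
def degeneratePoint (σ : ℝ) : ℝ := ((2 - σ) / (2 * (σ - 1))) ^ (1 / σ)

/-- The propagator `exp (i t p(|∇|))`. -/
def linearFlow (σ t : ℝ) : (R3 → ℂ) → (R3 → ℂ) :=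
  fourierMultiplier (fun ξ => Complex.exp (Complex.I * ((t * dispersion σ ‖ξ‖ : ℝ) : ℂ)))

/-- A radial function on `ℝ³`. -/
def IsRadial (g : R3 → ℝ) : Prop := ∀ ξ η : R3, ‖ξ‖ = ‖η‖ → g ξ = g η

/-- `Ψ` is a smooth radial cutoff with values in `[0,1]` which is `1` where `||ξ| - r₀| ≤ ε` and
`0` where `||ξ| - r₀| > 2ε`. -/
structure IsShellCutoff (r₀ ε : ℝ) (Ψ : R3 → ℝ) : Prop where
  smooth : ContDiff ℝ ∞ Ψ
  radial : IsRadial Ψ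
  mem_Icc : ∀ ξ, Ψ ξ ∈ Set.Icc (0 : ℝ) 1
  eq_one : ∀ ξ, |‖ξ‖ - r₀| ≤ ε → Ψ ξ = 1
  eq_zero : ∀ ξ, 2 * ε < |‖ξ‖ - r₀| → Ψ ξ = 0

/-- `ψ` is a smooth radial function with values in `[0,1]`, supported in `|ξ| ≤ 2` and equal to `1`
on `|ξ| ≤ 1`. -/
structure IsLittlewoodPaleyCutoff (ψ : R3 → ℝ) : Prop where
  smooth : ContDiff ℝ ∞ ψ
  radial : IsRadial ψ
  mem_Icc : ∀ ξ, ψ ξ ∈ Set.Icc (0 : ℝ) 1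
  tsupport_subset : tsupport ψ ⊆ {ξ | ‖ξ‖ ≤ 2}
  eq_one : ∀ ξ, ‖ξ‖ ≤ 1 → ψ ξ = 1

/-- The frequency localization `Q` with symbol `Ψ`. -/
def shellProj (Ψ : R3 → ℝ) : (R3 → ℂ) → (R3 → ℂ) :=
  fourierMultiplier (fun ξ => (Ψ ξ : ℂ))

/-- The Littlewood--Paley operator `P_N`, with symbol `ψ(ξ/N) - ψ(2ξ/N)`. -/
def littlewoodPaley (ψ : R3 → ℝ) (N : ℝ) : (R3 → ℂ) → (R3 → ℂ) :=
  fourierMultiplier (fun ξ => ((ψ (N⁻¹ • ξ) - ψ ((2 * N⁻¹) • ξ) : ℝ) : ℂ))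

end

/-! A multiplier with integrable symbol is convolution with the inverse Fourier transform of that
symbol, so each estimate reduces to a sup bound for a kernel (`eLpNorm_fourierInv_mul_fourier_le`).
For a radial symbol on ℝ³ the kernel is a double integral over `u ∈ [-1, 1]`, the cosine of the
angle to `w`, and the radius (`fourierInv_radial`). After rescaling, the phase is `T * phase s + ρ *
u * s` with `ρ = N * ‖w‖`.

Two regimes are separated in `exists_radial_integral_bound`. If `ρ` is small against `|T|`, there is
no stationary point, and two integrations by parts give `T⁻²`. Otherwise the `u`-integral is
computed explicitly; it yields a factor `1/ρ`, hence at most a multiple of `1/|T|`, and leaves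
one-dimensional integrals, which the second derivative test of van der Corput bounds.

Where `p''` is bounded away from zero this test gives `|T|^(-1/2)`, in total `|T|^(-3/2)`. At `r₀`
the second derivative vanishes to first order. Removing an interval of radius `δ` costs `δ`, the
rest costs `(|t| δ)^(-1/2)`, and `δ = |t|^(-1/3)` balances them, in total `|t|^(-4/3)`
(`exists_kernel_bound_degenerate`).

Uniformity in `N` comes from writing `p(N s)` as a scalar times `√(α s² + β s^(2-σ))` with `α + β =
1`. The parameters lie in a compact set that includes both limits `N → 0` and `N → ∞`, so derivative
bounds are uniform by compactness. Only the second derivative degenerates: by `phase₂_mul_eq` it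
carries a factor `β = 1/(1 + N^σ)`, as the phase becomes linear at high frequency. Tracking this
factor gives `N^(3/2 + 3σ/4) (1 + N^σ)^(-1/4)` in `exists_kernel_bound_nondegenerate`, from which
both stated powers of `N` follow. -/

/-! ### One-dimensional oscillatory integrals. -/

/-- The oscillating factor `exp (i θ(s))`. -/
noncomputable def osc (θ : ℝ → ℝ) (s : ℝ) : ℂ := Complex.exp ((θ s : ℂ) * Complex.I)

lemma norm_osc (θ : ℝ → ℝ) (s : ℝ) : ‖osc θ s‖ = 1 := Complex.norm_exp_ofReal_mul_I _

lemma HasDerivAt.osc {θ : ℝ → ℝ} {θ' s : ℝ} (h : HasDerivAt θ θ' s) :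
    HasDerivAt (osc θ) (osc θ s * ((θ' : ℂ) * Complex.I)) s :=
  (h.ofReal_comp.mul_const Complex.I).cexp

lemma ContinuousOn.osc {θ : ℝ → ℝ} {S : Set ℝ} (h : ContinuousOn θ S) :
    ContinuousOn (osc θ) S := by
  unfold _root_.osc
  exact ((Complex.continuous_ofReal.comp_continuousOn h).mul continuousOn_const).cexp

lemma osc_neg (θ : ℝ → ℝ) (s : ℝ) : osc (fun s => -θ s) s = (starRingEnd ℂ) (osc θ s) := by
  simp [osc, ← Complex.exp_conj]

/-- Integration by parts against an oscillating factor. -/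
lemma integral_osc_mul_eq {a b : ℝ} (hab : a ≤ b) {θ θ₁ θ₂ h h₁ : ℝ → ℝ}
    (d1 : ∀ s ∈ Set.Icc a b, HasDerivAt θ (θ₁ s) s)
    (d2 : ∀ s ∈ Set.Icc a b, HasDerivAt θ₁ (θ₂ s) s)
    (dh : ∀ s ∈ Set.Icc a b, HasDerivAt h (h₁ s) s)
    (c2 : ContinuousOn θ₂ (Set.Icc a b)) (ch : ContinuousOn h₁ (Set.Icc a b))
    (hne : ∀ s ∈ Set.Icc a b, θ₁ s ≠ 0) :
    ∫ s in a..b, osc θ s * (h s : ℂ) =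
      -Complex.I * (osc θ b * ((h b / θ₁ b : ℝ) : ℂ) - osc θ a * ((h a / θ₁ a : ℝ) : ℂ)
        - ∫ s in a..b, osc θ s * (((h₁ s * θ₁ s - h s * θ₂ s) / θ₁ s ^ 2 : ℝ) : ℂ)) := by
  have c0 : ContinuousOn θ (Set.Icc a b) := fun s hs => (d1 s hs).continuousAt.continuousWithinAt
  have c1 : ContinuousOn θ₁ (Set.Icc a b) := fun s hs => (d2 s hs).continuousAt.continuousWithinAt
  have cc : ContinuousOn h (Set.Icc a b) := fun s hs => (dh s hs).continuousAt.continuousWithinAt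
  have key := intervalIntegral.integral_mul_deriv_eq_deriv_mul (a := a) (b := b)
    (u := fun s => ((h s / θ₁ s : ℝ) : ℂ)) (v := osc θ)
    (u' := fun s => (((h₁ s * θ₁ s - h s * θ₂ s) / θ₁ s ^ 2 : ℝ) : ℂ))
    (v' := fun s => osc θ s * ((θ₁ s : ℂ) * Complex.I)) ?_ ?_ ?_ ?_
  · have e : ∫ s in a..b, ((h s / θ₁ s : ℝ) : ℂ) * (osc θ s * ((θ₁ s : ℂ) * Complex.I))
        = (∫ s in a..b, osc θ s * (h s : ℂ)) * Complex.I := by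
      rw [← intervalIntegral.integral_mul_const]
      apply intervalIntegral.integral_congr
      intro s hs
      rw [Set.uIcc_of_le hab] at hs
      have : (θ₁ s : ℂ) ≠ 0 := by exact_mod_cast hne s hs
      simp only [Complex.ofReal_div]
      field_simp
    rw [e] at key
    have e2 : ∫ s in a..b, osc θ s * (h s : ℂ)
        = -Complex.I * ((∫ s in a..b, osc θ s * (h s : ℂ)) * Complex.I) := by
      linear_combination (∫ s in a..b, osc θ s * (h s : ℂ)) * Complex.I_sq
    rw [e2, key]
    simp only [mul_comm (osc θ _)]
  · intro s hs
    rw [Set.uIcc_of_le hab] at hs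
    exact ((dh s hs).div (d2 s hs) (hne s hs)).ofReal_comp
  · intro s hs
    rw [Set.uIcc_of_le hab] at hs
    exact (d1 s hs).osc
  · apply ContinuousOn.intervalIntegrable
    rw [Set.uIcc_of_le hab]
    refine Complex.continuous_ofReal.comp_continuousOn ?_
    exact ((ch.mul c1).sub (cc.mul c2)).div (c1.pow 2) fun s hs => pow_ne_zero 2 (hne s hs)
  · apply ContinuousOn.intervalIntegrable
    rw [Set.uIcc_of_le hab]
    exact c0.osc.mul ((Complex.continuous_ofReal.comp_continuousOn c1).mul continuousOn_const)

/-- First derivative test for oscillatory integrals. -/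
lemma norm_integral_osc_le_of_le_deriv {a b l : ℝ} (hab : a ≤ b) (hl : 0 < l) {θ θ₁ θ₂ : ℝ → ℝ}
    (d1 : ∀ s ∈ Set.Icc a b, HasDerivAt θ (θ₁ s) s)
    (d2 : ∀ s ∈ Set.Icc a b, HasDerivAt θ₁ (θ₂ s) s)
    (c2 : ContinuousOn θ₂ (Set.Icc a b)) (h2 : ∀ s ∈ Set.Icc a b, 0 ≤ θ₂ s)
    (h1 : ∀ s ∈ Set.Icc a b, l ≤ |θ₁ s|) :
    ‖∫ s in a..b, osc θ s‖ ≤ 4 / l := by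
  have hne : ∀ s ∈ Set.Icc a b, θ₁ s ≠ 0 := fun s hs h => by
    have := h1 s hs; rw [h, abs_zero] at this; linarith
  have c1 : ContinuousOn θ₁ (Set.Icc a b) := fun s hs => (d2 s hs).continuousAt.continuousWithinAt
  have key := integral_osc_mul_eq hab (h := fun _ => 1) (h₁ := fun _ => 0) d1 d2
    (fun s _ => hasDerivAt_const s 1) c2 continuousOn_const hne
  simp only [Complex.ofReal_one, mul_one] at key
  rw [key]
  have bd : ∀ s ∈ Set.Icc a b, |1 / θ₁ s| ≤ 1 / l := fun s hs => by
    rw [abs_div, abs_one]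
    exact one_div_le_one_div_of_le hl (h1 s hs)
  have n1 : ∀ s ∈ Set.Icc a b, ‖osc θ s * ((1 / θ₁ s : ℝ) : ℂ)‖ ≤ 1 / l := fun s hs => by
    rw [norm_mul, norm_osc, one_mul, Complex.norm_real]
    exact bd s hs
  have n2 : ‖∫ s in a..b, osc θ s * (((0 * θ₁ s - 1 * θ₂ s) / θ₁ s ^ 2 : ℝ) : ℂ)‖ ≤ 2 / l := by
    have i2 : IntervalIntegrable (fun s => θ₂ s / θ₁ s ^ 2) volume a b := by
      apply ContinuousOn.intervalIntegrable
      rw [Set.uIcc_of_le hab]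
      exact c2.div (c1.pow 2) fun s hs => pow_ne_zero 2 (hne s hs)
    -- Since `θ₂ ≥ 0`, the reciprocal of `θ₁` is monotone, so its total variation telescopes to
    -- boundary values.
    have e : ∫ s in a..b, θ₂ s / θ₁ s ^ 2 = -(1 / θ₁ b) - -(1 / θ₁ a) := by
      apply intervalIntegral.integral_eq_sub_of_hasDerivAt (f := fun s => -(1 / θ₁ s)) _ i2
      intro s hs
      rw [Set.uIcc_of_le hab] at hs
      have := ((d2 s hs).inv (hne s hs)).neg
      rw [neg_div, neg_neg] at this
      convert this using 1
      ext; simp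
    calc _ ≤ ∫ s in a..b, θ₂ s / θ₁ s ^ 2 := by
          apply intervalIntegral.norm_integral_le_of_norm_le hab _ i2
          filter_upwards with s hs
          have hs' : s ∈ Set.Icc a b := ⟨hs.1.le, hs.2⟩
          rw [norm_mul, norm_osc, one_mul, Complex.norm_real, zero_mul, one_mul, zero_sub, neg_div,
            norm_neg, Real.norm_of_nonneg (div_nonneg (h2 s hs') (sq_nonneg _))]
      _ = -(1 / θ₁ b) - -(1 / θ₁ a) := e
      _ ≤ 2 / l := by
          have := abs_le.1 (bd b ⟨hab, le_rfl⟩)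
          have := abs_le.1 (bd a ⟨le_rfl, hab⟩)
          have : 2 / l = 1 / l + 1 / l := by ring
          linarith
  rw [norm_mul, norm_neg, Complex.norm_I, one_mul]
  refine (norm_sub_le _ _).trans ((add_le_add ((norm_sub_le _ _).trans
    (add_le_add (n1 b ⟨hab, le_rfl⟩) (n1 a ⟨le_rfl, hab⟩))) n2).trans (le_of_eq ?_))
  ring

lemma norm_integral_osc_le_length {a b : ℝ} (hab : a ≤ b) (θ : ℝ → ℝ) :
    ‖∫ s in a..b, osc θ s‖ ≤ b - a := by
  simpa [abs_of_nonneg (sub_nonneg.2 hab)] using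
    intervalIntegral.norm_integral_le_of_norm_le_const (a := a) (b := b) (C := 1)
      fun s _ => (norm_osc θ s).le

lemma integral_osc_add {a b c : ℝ} (hac : a ≤ c) (hcb : c ≤ b) {θ : ℝ → ℝ}
    (c0 : ContinuousOn θ (Set.Icc a b)) :
    ∫ s in a..b, osc θ s = (∫ s in a..c, osc θ s) + ∫ s in c..b, osc θ s := by
  rw [intervalIntegral.integral_add_adjacent_intervals]
  · apply ContinuousOn.intervalIntegrable
    rw [Set.uIcc_of_le hac]
    exact c0.osc.mono (Set.Icc_subset_Icc_right hcb)
  · apply ContinuousOn.intervalIntegrable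
    rw [Set.uIcc_of_le hcb]
    exact c0.osc.mono (Set.Icc_subset_Icc_left hac)

lemma mul_sub_le_sub_of_le_deriv {a b μ : ℝ} {f f' : ℝ → ℝ}
    (d : ∀ s ∈ Set.Icc a b, HasDerivAt f (f' s) s) (h : ∀ s ∈ Set.Icc a b, μ ≤ f' s)
    {x y : ℝ} (hx : a ≤ x) (hxy : x ≤ y) (hy : y ≤ b) : μ * (y - x) ≤ f y - f x := by
  apply (convex_Icc a b).mul_sub_le_image_sub_of_le_deriv _ _ _ x ⟨hx, hxy.trans hy⟩ y
    ⟨hx.trans hxy, hy⟩ hxy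
  · exact fun s hs => (d s hs).continuousAt.continuousWithinAt
  · exact fun s hs => (d s (interior_subset hs)).differentiableAt.differentiableWithinAt
  · intro s hs
    rw [(d s (interior_subset hs)).deriv]
    exact h s (interior_subset hs)

/-- Second derivative test (van der Corput), convex phase. -/
lemma norm_integral_osc_le_of_le_deriv2 {a b μ : ℝ} (hab : a ≤ b) (hμ : 0 < μ) {θ θ₁ θ₂ : ℝ → ℝ}
    (d1 : ∀ s ∈ Set.Icc a b, HasDerivAt θ (θ₁ s) s)
    (d2 : ∀ s ∈ Set.Icc a b, HasDerivAt θ₁ (θ₂ s) s)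
    (c2 : ContinuousOn θ₂ (Set.Icc a b)) (h2 : ∀ s ∈ Set.Icc a b, μ ≤ θ₂ s) :
    ‖∫ s in a..b, osc θ s‖ ≤ 10 / √μ := by
  have hsq : 0 < √μ := Real.sqrt_pos.2 hμ
  have hmm : μ * (1 / √μ) = √μ := by
    rw [mul_one_div, div_eq_iff hsq.ne', Real.mul_self_sqrt hμ.le]
  -- To the right of `c` the derivative grows at rate `μ`, so it exceeds `√μ` beyond distance
  -- `1/√μ`. The short piece costs its length and the rest `4/√μ` by the first derivative test.
  have right : ∀ c ∈ Set.Icc a b, 0 ≤ θ₁ c → ‖∫ s in c..b, osc θ s‖ ≤ 5 / √μ := by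
    intro c hc h0
    by_cases hle : b - c ≤ 1 / √μ
    · refine (norm_integral_osc_le_length hc.2 θ).trans (hle.trans ?_)
      gcongr; norm_num
    · push Not at hle
      have hδ : 0 < 1 / √μ := by positivity
      rw [integral_osc_add (c := c + 1 / √μ) (by linarith) (by linarith)
        fun s hs => (d1 s ⟨hc.1.trans hs.1, hs.2⟩).continuousAt.continuousWithinAt]
      have sub : ∀ s ∈ Set.Icc (c + 1 / √μ) b, s ∈ Set.Icc a b := fun s hs =>
        ⟨by linarith [hs.1, hc.1], hs.2⟩
      have n2 := norm_integral_osc_le_of_le_deriv (a := c + 1 / √μ) (b := b) (l := √μ)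
        (by linarith) hsq (fun s hs => d1 s (sub s hs)) (fun s hs => d2 s (sub s hs))
        (c2.mono sub) (fun s hs => hμ.le.trans (h2 s (sub s hs))) fun s hs => by
          have := mul_sub_le_sub_of_le_deriv d2 h2 hc.1 (by linarith [hs.1] : c ≤ s) hs.2
          have h3 : μ * (1 / √μ) ≤ μ * (s - c) := by
            apply mul_le_mul_of_nonneg_left _ hμ.le; linarith [hs.1]
          exact le_trans (by linarith) (le_abs_self _)
      have n1 := norm_integral_osc_le_length (a := c) (b := c + 1 / √μ) (by linarith) θ
      refine (norm_add_le _ _).trans ((add_le_add n1 n2).trans (le_of_eq ?_))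
      ring
  have left : ∀ c ∈ Set.Icc a b, θ₁ c ≤ 0 → ‖∫ s in a..c, osc θ s‖ ≤ 5 / √μ := by
    intro c hc h0
    by_cases hle : c - a ≤ 1 / √μ
    · refine (norm_integral_osc_le_length hc.1 θ).trans (hle.trans ?_)
      gcongr; norm_num
    · push Not at hle
      have hδ : 0 < 1 / √μ := by positivity
      rw [integral_osc_add (c := c - 1 / √μ) (by linarith) (by linarith)
        fun s hs => (d1 s ⟨hs.1, hs.2.trans hc.2⟩).continuousAt.continuousWithinAt]
      have sub : ∀ s ∈ Set.Icc a (c - 1 / √μ), s ∈ Set.Icc a b := fun s hs =>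
        ⟨hs.1, by linarith [hs.2, hc.2]⟩
      have n2 := norm_integral_osc_le_of_le_deriv (a := a) (b := c - 1 / √μ) (l := √μ)
        (by linarith) hsq (fun s hs => d1 s (sub s hs)) (fun s hs => d2 s (sub s hs))
        (c2.mono sub) (fun s hs => hμ.le.trans (h2 s (sub s hs))) fun s hs => by
          have := mul_sub_le_sub_of_le_deriv d2 h2 hs.1 (by linarith [hs.2] : s ≤ c) hc.2
          have h3 : μ * (1 / √μ) ≤ μ * (c - s) := by
            apply mul_le_mul_of_nonneg_left _ hμ.le; linarith [hs.2]
          exact le_trans (by linarith) (neg_le_abs _)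
      have n1 := norm_integral_osc_le_length (a := c - 1 / √μ) (b := c) (by linarith) θ
      refine (norm_add_le _ _).trans ((add_le_add n2 n1).trans (le_of_eq ?_))
      ring
  have h510 : 5 / √μ ≤ 10 / √μ := by gcongr; norm_num
  have ha : a ∈ Set.Icc a b := ⟨le_rfl, hab⟩
  have hb : b ∈ Set.Icc a b := ⟨hab, le_rfl⟩
  by_cases h0 : 0 ≤ θ₁ a
  · exact (right a ha h0).trans h510
  by_cases h1 : θ₁ b ≤ 0
  · exact (left b hb h1).trans h510
  push Not at h0 h1
  obtain ⟨c, hc, hc0⟩ := intermediate_value_Icc hab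
    (fun s hs => (d2 s hs).continuousAt.continuousWithinAt : ContinuousOn θ₁ _) ⟨h0.le, h1.le⟩
  rw [integral_osc_add hc.1 hc.2 fun s hs => (d1 s hs).continuousAt.continuousWithinAt]
  refine (norm_add_le _ _).trans ((add_le_add (left c hc hc0.le) (right c hc hc0.ge)).trans
    (le_of_eq ?_))
  ring

/-- Second derivative test (van der Corput). -/
lemma norm_integral_osc_le_of_le_abs_deriv2 {a b μ : ℝ} (hab : a ≤ b) (hμ : 0 < μ)
    {θ θ₁ θ₂ : ℝ → ℝ}
    (d1 : ∀ s ∈ Set.Icc a b, HasDerivAt θ (θ₁ s) s)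
    (d2 : ∀ s ∈ Set.Icc a b, HasDerivAt θ₁ (θ₂ s) s)
    (c2 : ContinuousOn θ₂ (Set.Icc a b)) (h2 : ∀ s ∈ Set.Icc a b, μ ≤ |θ₂ s|) :
    ‖∫ s in a..b, osc θ s‖ ≤ 10 / √μ := by
  have hne : ∀ s ∈ Set.Icc a b, θ₂ s ≠ 0 := fun s hs h => by
    have := h2 s hs; rw [h, abs_zero] at this; linarith
  by_cases hpos : ∀ s ∈ Set.Icc a b, 0 < θ₂ s
  · exact norm_integral_osc_le_of_le_deriv2 hab hμ d1 d2 c2 fun s hs => by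
      simpa [abs_of_pos (hpos s hs)] using h2 s hs
  · have hneg : ∀ s ∈ Set.Icc a b, θ₂ s < 0 := by
      intro s hs
      by_contra hcon
      push Not at hcon hpos
      obtain ⟨y, hy, hy0⟩ := hpos
      obtain ⟨z, hz, hz0⟩ := isPreconnected_Icc.intermediate_value hy hs c2 ⟨hy0, hcon⟩
      exact hne z hz hz0
    -- Negating the phase conjugates the integral and makes the phase convex.
    have key := norm_integral_osc_le_of_le_deriv2 (θ := fun s => -θ s) (θ₁ := fun s => -θ₁ s)
      (θ₂ := fun s => -θ₂ s) hab hμ (fun s hs => (d1 s hs).neg) (fun s hs => (d2 s hs).neg)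
      c2.neg fun s hs => by simpa [abs_of_neg (hneg s hs)] using h2 s hs
    simp_rw [osc_neg] at key
    rwa [intervalIntegral.integral_of_le hab, integral_conj,
      ← intervalIntegral.integral_of_le hab, RCLike.norm_conj] at key

/-- Insertion of an amplitude into a bound for an oscillatory integral. -/
lemma norm_integral_osc_mul_le {a b B M : ℝ} (hab : a ≤ b) {θ h h₁ : ℝ → ℝ}
    (c0 : ContinuousOn θ (Set.Icc a b))
    (dh : ∀ s ∈ Set.Icc a b, HasDerivAt h (h₁ s) s) (ch : ContinuousOn h₁ (Set.Icc a b))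
    (hB : ∀ x ∈ Set.Icc a b, ‖∫ s in a..x, osc θ s‖ ≤ B)
    (bh : ∀ s ∈ Set.Icc a b, |h s| ≤ M) (bh1 : ∀ s ∈ Set.Icc a b, |h₁ s| ≤ M) :
    ‖∫ s in a..b, osc θ s * (h s : ℂ)‖ ≤ B * M * (1 + (b - a)) := by
  set F : ℝ → ℂ := fun x => ∫ s in a..x, osc θ s with hF
  have hB0 : 0 ≤ B := (norm_nonneg _).trans (hB a ⟨le_rfl, hab⟩)
  have io : IntervalIntegrable (osc θ) volume a b := by
    apply ContinuousOn.intervalIntegrable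
    rw [Set.uIcc_of_le hab]; exact c0.osc
  have cF : ContinuousOn F (Set.Icc a b) := by
    have := intervalIntegral.continuousOn_primitive_interval' io (a := a) Set.left_mem_uIcc
    rwa [Set.uIcc_of_le hab] at this
  -- The derivative falls on the amplitude while the primitive `F` of the oscillation stays bounded
  -- by `B`; this is why the bound is assumed on every initial segment.
  have key := intervalIntegral.integral_mul_deriv_eq_deriv_mul_of_hasDeriv_right
    (a := a) (b := b) (u := fun s => ((h s : ℝ) : ℂ)) (v := F)
    (u' := fun s => ((h₁ s : ℝ) : ℂ)) (v' := osc θ) ?_ ?_ ?_ ?_ ?_ ?_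
  · have e : ∫ s in a..b, osc θ s * (h s : ℂ) = ∫ s in a..b, (h s : ℂ) * osc θ s := by
      simp only [mul_comm]
    have hFa : F a = 0 := by simp [hF]
    rw [e, key, hFa, mul_zero, sub_zero]
    have n1 : ‖(h b : ℂ) * F b‖ ≤ B * M := by
      rw [norm_mul, Complex.norm_real, mul_comm]
      exact mul_le_mul (hB b ⟨hab, le_rfl⟩) (bh b ⟨hab, le_rfl⟩) (abs_nonneg _) hB0
    have n2 : ‖∫ s in a..b, (h₁ s : ℂ) * F s‖ ≤ B * M * |b - a| := by
      apply intervalIntegral.norm_integral_le_of_norm_le_const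
      intro s hs
      rw [Set.uIoc_of_le hab] at hs
      have hs' : s ∈ Set.Icc a b := ⟨hs.1.le, hs.2⟩
      rw [norm_mul, Complex.norm_real, mul_comm]
      exact mul_le_mul (hB s hs') (bh1 s hs') (abs_nonneg _) hB0
    rw [abs_of_nonneg (sub_nonneg.2 hab)] at n2
    refine (norm_sub_le _ _).trans ((add_le_add n1 n2).trans (le_of_eq ?_))
    ring
  · rw [Set.uIcc_of_le hab]
    exact Complex.continuous_ofReal.comp_continuousOn
      fun s hs => (dh s hs).continuousAt.continuousWithinAt
  · rwa [Set.uIcc_of_le hab]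
  · intro s hs
    rw [min_eq_left hab, max_eq_right hab] at hs
    exact (dh s ⟨hs.1.le, hs.2.le⟩).ofReal_comp.hasDerivWithinAt
  · intro s hs
    rw [min_eq_left hab, max_eq_right hab] at hs
    have hn : Set.Icc a b ∈ nhds s := Icc_mem_nhds hs.1 hs.2
    apply HasDerivAt.hasDerivWithinAt
    apply intervalIntegral.integral_hasDerivAt_right (io.mono_set ?_) ?_
      (c0.osc.continuousAt hn)
    · rw [Set.uIcc_of_le hab, Set.uIcc_of_le hs.1.le]
      exact Set.Icc_subset_Icc_right hs.2.le
    · exact ContinuousOn.stronglyMeasurableAtFilter isOpen_Ioo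
        (c0.osc.mono Set.Ioo_subset_Icc_self) s hs
  · apply ContinuousOn.intervalIntegrable
    rw [Set.uIcc_of_le hab]
    exact Complex.continuous_ofReal.comp_continuousOn ch
  · exact io

/-- Non-stationary phase: two integrations by parts. -/
lemma norm_integral_osc_mul_le_of_nonstationary {a b l A M : ℝ} (hab : a ≤ b) (hl : 0 < l)
    (hA : 1 ≤ A) (hM : 0 ≤ M) {θ θ₁ θ₂ θ₃ h h₁ h₂ : ℝ → ℝ}
    (d1 : ∀ s ∈ Set.Icc a b, HasDerivAt θ (θ₁ s) s)
    (d2 : ∀ s ∈ Set.Icc a b, HasDerivAt θ₁ (θ₂ s) s)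
    (d3 : ∀ s ∈ Set.Icc a b, HasDerivAt θ₂ (θ₃ s) s)
    (c3 : ContinuousOn θ₃ (Set.Icc a b))
    (dh : ∀ s ∈ Set.Icc a b, HasDerivAt h (h₁ s) s)
    (dh1 : ∀ s ∈ Set.Icc a b, HasDerivAt h₁ (h₂ s) s)
    (ch : ContinuousOn h₂ (Set.Icc a b))
    (za : h a = 0) (zb : h b = 0) (za1 : h₁ a = 0) (zb1 : h₁ b = 0)
    (b1 : ∀ s ∈ Set.Icc a b, l ≤ |θ₁ s|)
    (b2 : ∀ s ∈ Set.Icc a b, |θ₂ s| ≤ A * l) (b3 : ∀ s ∈ Set.Icc a b, |θ₃ s| ≤ A * l)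
    (bh : ∀ s ∈ Set.Icc a b, |h s| ≤ M) (bh1 : ∀ s ∈ Set.Icc a b, |h₁ s| ≤ M)
    (bh2 : ∀ s ∈ Set.Icc a b, |h₂ s| ≤ M) :
    ‖∫ s in a..b, osc θ s * (h s : ℂ)‖ ≤ 8 * M * A ^ 2 * (b - a) / l ^ 2 := by
  have hne : ∀ s ∈ Set.Icc a b, θ₁ s ≠ 0 := fun s hs h => by
    have := b1 s hs; rw [h, abs_zero] at this; linarith
  have c1 : ContinuousOn θ₁ (Set.Icc a b) := fun s hs => (d2 s hs).continuousAt.continuousWithinAt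
  have c2 : ContinuousOn θ₂ (Set.Icc a b) := fun s hs => (d3 s hs).continuousAt.continuousWithinAt
  have k0 : ContinuousOn h (Set.Icc a b) := fun s hs => (dh s hs).continuousAt.continuousWithinAt
  have k1 : ContinuousOn h₁ (Set.Icc a b) := fun s hs => (dh1 s hs).continuousAt.continuousWithinAt
  set g : ℝ → ℝ := fun s => (h₁ s * θ₁ s - h s * θ₂ s) / θ₁ s ^ 2 with hg
  set g₁ : ℝ → ℝ := fun s => ((h₂ s * θ₁ s - h s * θ₃ s) * θ₁ s ^ 2
    - (h₁ s * θ₁ s - h s * θ₂ s) * (2 * θ₁ s * θ₂ s)) / (θ₁ s ^ 2) ^ 2 with hg₁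
  have dg : ∀ s ∈ Set.Icc a b, HasDerivAt g (g₁ s) s := by
    intro s hs
    have := (((dh1 s hs).mul (d2 s hs)).sub ((dh s hs).mul (d3 s hs))).div ((d2 s hs).pow 2)
      (pow_ne_zero 2 (hne s hs))
    refine HasDerivAt.congr_deriv this ?_
    simp only [hg₁, Pi.mul_apply, Pi.sub_apply, Pi.pow_apply]
    congr 1
    push_cast
    ring
  have cg : ContinuousOn g₁ (Set.Icc a b) := by
    refine ContinuousOn.div ?_ ((c1.pow 2).pow 2) fun s hs => pow_ne_zero 2 (pow_ne_zero 2 (hne s hs))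
    exact (((ch.mul c1).sub (k0.mul c3)).mul (c1.pow 2)).sub
      (((k1.mul c1).sub (k0.mul c2)).mul ((continuousOn_const.mul c1).mul c2))
  have e1 := integral_osc_mul_eq hab d1 d2 dh c2 k1 hne
  have e2 := integral_osc_mul_eq hab d1 d2 dg c2 cg hne
  have ga : g a = 0 := by simp [hg, za, za1]
  have gb : g b = 0 := by simp [hg, zb, zb1]
  simp only [za, zb, zero_div, Complex.ofReal_zero, mul_zero, sub_zero, zero_sub] at e1
  simp only [ga, gb, zero_div, Complex.ofReal_zero, mul_zero, sub_zero, zero_sub] at e2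
  rw [e1]
  simp only [hg] at e2
  rw [e2, norm_mul, norm_neg, norm_neg, norm_mul, norm_neg, norm_neg, Complex.norm_I, one_mul,
    one_mul]
  have := intervalIntegral.norm_integral_le_of_norm_le_const (a := a) (b := b)
    (f := fun s => osc θ s * (((g₁ s * θ₁ s - g s * θ₂ s) / θ₁ s ^ 2 : ℝ) : ℂ))
    (C := 8 * M * A ^ 2 / l ^ 2) ?_
  · rw [abs_of_nonneg (sub_nonneg.2 hab)] at this
    refine this.trans (le_of_eq ?_)
    ring
  intro s hs
  rw [Set.uIoc_of_le hab] at hs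
  have hs' : s ∈ Set.Icc a b := ⟨hs.1.le, hs.2⟩
  have hs0 := hne s hs'
  rw [norm_mul, norm_osc, one_mul, Complex.norm_real, Real.norm_eq_abs]
  set x := θ₂ s / θ₁ s with hx
  set y := θ₃ s / θ₁ s with hy
  have hθ : 0 < |θ₁ s| := abs_pos.2 hs0
  have bx : |x| ≤ A := by
    rw [hx, abs_div, div_le_iff₀ hθ]
    exact (b2 s hs').trans (mul_le_mul_of_nonneg_left (b1 s hs') (by linarith))
  have by' : |y| ≤ A := by
    rw [hy, abs_div, div_le_iff₀ hθ]
    exact (b3 s hs').trans (mul_le_mul_of_nonneg_left (b1 s hs') (by linarith))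
  -- In the ratios `x`, `y`, bounded by `A`, the coefficients `1 + 3 + 1 + 3` add up to the constant
  -- `8`.
  have e : (g₁ s * θ₁ s - g s * θ₂ s) / θ₁ s ^ 2
      = (h₂ s - 3 * (h₁ s * x) - h s * y + 3 * (h s * x ^ 2)) / θ₁ s ^ 2 := by
    simp only [hg₁, hg, hx, hy]
    field_simp
    ring
  rw [e, abs_div, abs_of_nonneg (sq_nonneg (θ₁ s))]
  have n1 : |h₁ s * x| ≤ M * A := by
    rw [abs_mul]; exact mul_le_mul (bh1 s hs') bx (abs_nonneg _) hM
  have n2 : |h s * y| ≤ M * A := by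
    rw [abs_mul]; exact mul_le_mul (bh s hs') by' (abs_nonneg _) hM
  have n3 : |h s * x ^ 2| ≤ M * A ^ 2 := by
    rw [abs_mul, abs_pow]
    exact mul_le_mul (bh s hs') (pow_le_pow_left₀ (abs_nonneg _) bx 2) (by positivity) hM
  have hMA : M ≤ M * A := le_mul_of_one_le_right hM hA
  have hMA2 : M * A ≤ M * A ^ 2 := by
    apply mul_le_mul_of_nonneg_left _ hM; nlinarith
  apply div_le_div₀ (by positivity) _ (by positivity)
  · rw [← sq_abs (θ₁ s)]; exact pow_le_pow_left₀ hl.le (b1 s hs') 2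
  · have n0 := abs_le.1 (bh2 s hs')
    have n1 := abs_le.1 n1
    have n2 := abs_le.1 n2
    have n3 := abs_le.1 n3
    rw [abs_le]
    constructor <;> linarith

/-! ### The inverse Fourier transform of radial functions. -/

/-- `ℝ³` is isometric to `ℝ × ℂ`, with a prescribed vector on the positive first axis. -/
lemma exists_isometry_prod_complex (w : R3) :
    ∃ L : R3 ≃ₗᵢ[ℝ] WithLp 2 (ℝ × ℂ), L w = WithLp.toLp 2 (‖w‖, 0) := by
  have hf : Module.finrank ℝ (WithLp 2 (ℝ × ℂ)) = 3 := by
    rw [(WithLp.linearEquiv 2 ℝ (ℝ × ℂ)).finrank_eq]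
    simp
  let L₀ : R3 ≃ₗᵢ[ℝ] WithLp 2 (ℝ × ℂ) :=
    (((stdOrthonormalBasis ℝ (WithLp 2 (ℝ × ℂ))).reindex (finCongr hf)).repr).symm
  have hn : ‖L₀ w‖ = ‖WithLp.toLp 2 (‖w‖, (0 : ℂ))‖ := by
    rw [L₀.norm_map, WithLp.prod_norm_eq_of_L2]
    simp
  -- Two vectors of equal norm are exchanged by reflection in the hyperplane orthogonal to their
  -- difference.
  refine ⟨L₀.trans (Submodule.reflection (ℝ ∙ (L₀ w - WithLp.toLp 2 (‖w‖, (0 : ℂ))))ᗮ), ?_⟩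
  simpa using Submodule.reflection_sub hn

lemma hasCompactSupport_of_norm_le {E F : Type*} [NormedAddCommGroup E] [ProperSpace E] [Zero F]
    {f : E → F} (R : ℝ) (h : ∀ x, f x ≠ 0 → ‖x‖ ≤ R) : HasCompactSupport f := by
  apply HasCompactSupport.intro (isCompact_closedBall (0 : E) R)
  intro x hx
  by_contra hne
  exact hx (by simpa using h x hne)

/-- The weight `max y 0` is continuous on the whole line and vanishes for negative `y`, so the
half-plane integral becomes an integral over `ℝ × ℝ`, to which planar polar coordinates apply. -/
lemma integral_max_mul (f : ℝ → ℂ) :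
    ∫ y : ℝ, ((max y 0 : ℝ) : ℂ) * f y = ∫ y in Set.Ioi (0 : ℝ), (y : ℂ) * f y := by
  rw [← setIntegral_eq_integral_of_forall_compl_eq_zero (s := Set.Ioi (0 : ℝ))]
  · apply setIntegral_congr_fun measurableSet_Ioi
    intro y hy
    simp only [max_eq_left (le_of_lt (Set.mem_Ioi.1 hy))]
  · intro y hy
    rw [Set.mem_Ioi, not_lt] at hy
    simp [max_eq_right hy]

lemma integral_complex_radial (f : ℝ → ℂ) :
    ∫ z : ℂ, f ‖z‖ = 2 * Real.pi * ∫ y in Set.Ioi (0 : ℝ), (y : ℂ) * f y := by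
  rw [integral_fun_norm_addHaar volume f]
  have hv : (volume : Measure ℂ).real (Metric.ball 0 1) = Real.pi := by
    simp [Measure.real, Complex.volume_ball]
  rw [hv, Complex.finrank_real_complex]
  simp [mul_assoc]

/-- Polar coordinates in the half plane. -/
lemma integral_halfPlane {G : ℝ × ℝ → ℂ} {a b κ : ℝ} (ha : 0 < a) (hab : a ≤ b) {g : ℝ → ℂ}
    (hg : Continuous g) (h0 : ∀ r, r ∉ Set.Icc a b → g r = 0)
    (hG : G = fun p => Complex.exp (((κ * p.1 : ℝ) : ℂ) * Complex.I) *
      (((max p.2 0 : ℝ) : ℂ) * g (√(p.1 ^ 2 + p.2 ^ 2)))) :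
    ∫ p, G p = ∫ u in (-1 : ℝ)..1, ∫ r in a..b,
      Complex.exp (((κ * r * u : ℝ) : ℂ) * Complex.I) * ((r : ℂ) ^ 2 * g r) := by
  set V : ℝ → ℂ := fun u => ∫ r in a..b,
      Complex.exp (((κ * r * u : ℝ) : ℂ) * Complex.I) * ((r : ℂ) ^ 2 * g r) with hV
  have hVc : Continuous V := by
    apply intervalIntegral.continuous_parametric_intervalIntegral_of_continuous'
    simp only [Function.uncurry_def]
    fun_prop
  rw [← integral_comp_polarCoord_symm]
  have hF : ∀ p ∈ polarCoord.target, p.1 • G (polarCoord.symm p) =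
      Complex.exp (((κ * p.1 * Real.cos p.2 : ℝ) : ℂ) * Complex.I) * ((p.1 : ℂ) ^ 2 * g p.1) *
        ((max (Real.sin p.2) 0 : ℝ) : ℂ) := by
    rintro ⟨r, θ⟩ hp
    rw [polarCoord_target] at hp
    have hr : 0 < r := hp.1
    have e1 : √((r * Real.cos θ) ^ 2 + (r * Real.sin θ) ^ 2) = r := by
      have : (r * Real.cos θ) ^ 2 + (r * Real.sin θ) ^ 2 = r ^ 2 := by
        linear_combination r ^ 2 * Real.cos_sq_add_sin_sq θ
      rw [this, Real.sqrt_sq hr.le]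
    have e2 : max (r * Real.sin θ) 0 = r * max (Real.sin θ) 0 := by
      rw [mul_max_of_nonneg _ _ hr.le, mul_zero]
    simp only [polarCoord_symm_apply, hG, e1, e2, Complex.real_smul]
    push_cast
    ring_nf
  rw [setIntegral_congr_fun (by rw [polarCoord_target]; measurability) hF, polarCoord_target,
    Measure.volume_eq_prod]
  have hint : IntegrableOn (fun p : ℝ × ℝ =>
      Complex.exp (((κ * p.1 * Real.cos p.2 : ℝ) : ℂ) * Complex.I) * ((p.1 : ℂ) ^ 2 * g p.1) *
        ((max (Real.sin p.2) 0 : ℝ) : ℂ)) (Set.Ioi 0 ×ˢ Set.Ioo (-Real.pi) Real.pi)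
      (volume.prod volume) := by
    have hc : Continuous (fun p : ℝ × ℝ =>
      Complex.exp (((κ * p.1 * Real.cos p.2 : ℝ) : ℂ) * Complex.I) * ((p.1 : ℂ) ^ 2 * g p.1) *
        ((max (Real.sin p.2) 0 : ℝ) : ℂ)) := by fun_prop
    have h1 := (hc.continuousOn (s := Set.Icc a b ×ˢ Set.Icc (-Real.pi) Real.pi)).integrableOn_compact
      (μ := volume.prod volume) (isCompact_Icc.prod isCompact_Icc)
    apply IntegrableOn.of_forall_sdiff_eq_zero (h1.mono_set (s := Set.Icc a b ×ˢ
      Set.Ioo (-Real.pi) Real.pi) (Set.prod_mono le_rfl Set.Ioo_subset_Icc_self))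
      (measurableSet_Ioi.prod measurableSet_Ioo)
    rintro ⟨r, θ⟩ ⟨h1, h2⟩
    have : r ∉ Set.Icc a b := fun h => h2 ⟨h, h1.2⟩
    simp [h0 r this]
  rw [← setIntegral_prod_swap]
  refine (setIntegral_prod _ hint.swap).trans ?_
  have inner : ∀ θ : ℝ, ∫ r in Set.Ioi (0 : ℝ),
      Complex.exp (((κ * r * Real.cos θ : ℝ) : ℂ) * Complex.I) * ((r : ℂ) ^ 2 * g r) *
        ((max (Real.sin θ) 0 : ℝ) : ℂ) = V (Real.cos θ) * ((max (Real.sin θ) 0 : ℝ) : ℂ) := by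
    intro θ
    rw [integral_mul_const, hV]
    congr 1
    simp only
    rw [intervalIntegral.integral_of_le hab, ← integral_Icc_eq_integral_Ioc]
    apply setIntegral_eq_of_subset_of_forall_sdiff_eq_zero measurableSet_Ioi
    · exact fun r hr => ha.trans_le hr.1
    · intro r hr
      simp [h0 r hr.2]
  simp only [Function.comp_apply, Prod.swap_prod_mk]
  rw [setIntegral_congr_fun measurableSet_Ioo fun θ _ => inner θ]
  have pos : ∫ θ in Set.Ioo (-Real.pi) Real.pi, V (Real.cos θ) * ((max (Real.sin θ) 0 : ℝ) : ℂ) =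
      ∫ θ in (0 : ℝ)..Real.pi, V (Real.cos θ) * (Real.sin θ : ℂ) := by
    rw [intervalIntegral.integral_of_le Real.pi_pos.le, integral_Ioc_eq_integral_Ioo]
    have : ∫ θ in Set.Ioo (-Real.pi) Real.pi, V (Real.cos θ) * ((max (Real.sin θ) 0 : ℝ) : ℂ) =
        ∫ θ in Set.Ioo 0 Real.pi, V (Real.cos θ) * ((max (Real.sin θ) 0 : ℝ) : ℂ) := by
      apply setIntegral_eq_of_subset_of_forall_sdiff_eq_zero measurableSet_Ioo
      · exact Set.Ioo_subset_Ioo_left (by linarith [Real.pi_pos])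
      · rintro θ ⟨h1, h2⟩
        have hθ : θ ≤ 0 := by
          by_contra h
          exact h2 ⟨not_le.1 h, h1.2⟩
        have := Real.sin_nonpos_of_nonpos_of_neg_pi_le hθ h1.1.le
        simp [max_eq_right this]
    rw [this]
    apply setIntegral_congr_fun measurableSet_Ioo
    intro θ hθ
    simp only [max_eq_left (Real.sin_nonneg_of_nonneg_of_le_pi hθ.1.le hθ.2.le)]
  rw [pos]
  -- Substitution `u = cos θ`; the factor `sin θ` left by the weight is exactly its Jacobian.
  have cv := intervalIntegral.integral_deriv_smul_comp (a := 0) (b := Real.pi) (f := Real.cos)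
    (f' := fun θ => -Real.sin θ) (g := V) (fun θ _ => Real.hasDerivAt_cos θ)
    (by fun_prop) hVc
  rw [Real.cos_zero, Real.cos_pi, intervalIntegral.integral_symm (-1) 1] at cv
  rw [← neg_inj, ← cv, ← intervalIntegral.integral_neg]
  apply intervalIntegral.integral_congr
  intro θ _
  simp [mul_comm]

/-- The inverse Fourier transform of a radial function on `ℝ³`. -/
lemma fourierInv_radial {a b : ℝ} (ha : 0 < a) (hab : a ≤ b) {g : ℝ → ℂ}
    (hg : Continuous g) (h0 : ∀ r, r ∉ Set.Icc a b → g r = 0) (w : R3) :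
    𝓕⁻ (fun y : R3 => g ‖y‖) w = 2 * Real.pi * ∫ u in (-1 : ℝ)..1, ∫ r in a..b,
      Complex.exp (((2 * Real.pi * ‖w‖ * r * u : ℝ) : ℂ) * Complex.I) * ((r : ℂ) ^ 2 * g r) := by
  obtain ⟨L, hL⟩ := exists_isometry_prod_complex w
  set κ := 2 * Real.pi * ‖w‖ with hκ
  set F : ℝ × ℂ → ℂ := fun p => Complex.exp (((κ * p.1 : ℝ) : ℂ) * Complex.I) *
    g (√(p.1 ^ 2 + ‖p.2‖ ^ 2)) with hF
  have e1 : 𝓕⁻ (fun y : R3 => g ‖y‖) w = ∫ p, F p := by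
    rw [Real.fourierInv_eq']
    have : ∀ v : R3, Complex.exp (((2 * Real.pi * inner ℝ v w : ℝ) : ℂ) * Complex.I) • g ‖v‖ =
        F (WithLp.ofLp (L v)) := by
      intro v
      have h1 : inner ℝ v w = (L v).fst * ‖w‖ := by
        rw [← L.inner_map_map, hL, WithLp.prod_inner_apply]
        simp [mul_comm]
      have h2 : ‖v‖ = √((L v).fst ^ 2 + ‖(L v).snd‖ ^ 2) := by
        rw [← L.norm_map, WithLp.prod_norm_eq_of_L2]
        simp
      rw [h1, h2, smul_eq_mul, hF, hκ]
      simp only [WithLp.ofLp_fst, WithLp.ofLp_snd]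
      ring_nf
    simp_rw [this]
    rw [L.measurePreserving.integral_comp L.toHomeomorph.measurableEmbedding
      (fun q => F (WithLp.ofLp q))]
    exact (WithLp.volume_preserving_ofLp ℝ ℂ).integral_comp
      (MeasurableEquiv.toLp 2 (ℝ × ℂ)).symm.measurableEmbedding F
  have hFi : Integrable F := by
    apply Continuous.integrable_of_hasCompactSupport
    · simp only [hF]; fun_prop
    · apply hasCompactSupport_of_norm_le b
      rintro ⟨x, z⟩ hp
      have : √(x ^ 2 + ‖z‖ ^ 2) ∈ Set.Icc a b := by
        by_contra h
        exact hp (by simp [hF, h0 _ h])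
      refine le_trans ?_ this.2
      apply Real.le_sqrt_of_sq_le
      rcases max_choice ‖x‖ ‖z‖ with h | h
      · rw [Prod.norm_def, h, Real.norm_eq_abs, sq_abs]; nlinarith [sq_nonneg ‖z‖]
      · rw [Prod.norm_def, h]; nlinarith [sq_nonneg x]
  -- Rotational symmetry about the axis of `w` replaces the complex variable by its modulus, at the
  -- price of the weight `2πy` on the half-line.
  set G : ℝ × ℝ → ℂ := fun p => Complex.exp (((κ * p.1 : ℝ) : ℂ) * Complex.I) *
      (((max p.2 0 : ℝ) : ℂ) * g (√(p.1 ^ 2 + p.2 ^ 2))) with hG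
  have hGi : Integrable G := by
    apply Continuous.integrable_of_hasCompactSupport
    · simp only [hG]; fun_prop
    · apply hasCompactSupport_of_norm_le b
      rintro ⟨x, z⟩ hp
      have : √(x ^ 2 + z ^ 2) ∈ Set.Icc a b := by
        by_contra h
        exact hp (by simp [hG, h0 _ h])
      refine le_trans ?_ this.2
      apply Real.le_sqrt_of_sq_le
      rcases max_choice ‖x‖ ‖z‖ with h | h
      · rw [Prod.norm_def, h, Real.norm_eq_abs, sq_abs]; nlinarith [sq_nonneg z]
      · rw [Prod.norm_def, h, Real.norm_eq_abs, sq_abs]; nlinarith [sq_nonneg x]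
  rw [e1, ← integral_halfPlane ha hab hg h0 hG]
  rw [Measure.volume_eq_prod] at hFi hGi ⊢
  rw [integral_prod _ hFi, Measure.volume_eq_prod, integral_prod _ hGi, ← integral_const_mul]
  congr 1
  ext x
  simp only [hF, hG]
  rw [integral_const_mul, integral_const_mul, integral_complex_radial
    (fun y => g √(x ^ 2 + y ^ 2)), integral_max_mul]
  ring

/-! ### Radial oscillatory integrals. -/

lemma osc_add_mul (q : ℝ → ℝ) (κ s : ℝ) :
    osc (fun s => q s + κ * s) s = osc q s * Complex.exp (((κ * s : ℝ) : ℂ) * Complex.I) := by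
  simp only [osc, Complex.ofReal_add, add_mul, Complex.exp_add]

/-- Bound for a radial oscillatory integral, in the region without stationary points. -/
lemma norm_radial_integral_le_of_nonstationary {a b c A M T ρ : ℝ} (ha : 0 < a) (hab : a ≤ b)
    (hc : 0 < c) (hA : 1 ≤ A) (hM : 0 ≤ M) (hT : T ≠ 0) (hρ : |ρ| ≤ c * |T| / 2)
    {q q₁ q₂ q₃ m m₁ m₂ : ℝ → ℝ}
    (d1 : ∀ s ∈ Set.Icc a b, HasDerivAt q (q₁ s) s)
    (d2 : ∀ s ∈ Set.Icc a b, HasDerivAt q₁ (q₂ s) s)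
    (d3 : ∀ s ∈ Set.Icc a b, HasDerivAt q₂ (q₃ s) s)
    (c3 : ContinuousOn q₃ (Set.Icc a b))
    (dm : ∀ s ∈ Set.Icc a b, HasDerivAt m (m₁ s) s)
    (dm1 : ∀ s ∈ Set.Icc a b, HasDerivAt m₁ (m₂ s) s)
    (cm : ContinuousOn m₂ (Set.Icc a b))
    (za : m a = 0) (zb : m b = 0) (za1 : m₁ a = 0) (zb1 : m₁ b = 0)
    (b1 : ∀ s ∈ Set.Icc a b, c ≤ q₁ s)
    (b2 : ∀ s ∈ Set.Icc a b, |q₂ s| ≤ A * c) (b3 : ∀ s ∈ Set.Icc a b, |q₃ s| ≤ A * c)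
    (bm : ∀ s ∈ Set.Icc a b, |m s| ≤ M) (bm1 : ∀ s ∈ Set.Icc a b, |m₁ s| ≤ M)
    (bm2 : ∀ s ∈ Set.Icc a b, |m₂ s| ≤ M) :
    ‖∫ u in (-1 : ℝ)..1, ∫ s in a..b, osc (fun s => T * q s + (ρ * u) * s) s *
      ((m s * s ^ 2 : ℝ) : ℂ)‖ ≤ 256 * M * (b ^ 2 + 4 * b + 2) * A ^ 2 * (b - a) / c ^ 2
        * (1 / T ^ 2) := by
  have hT' : 0 < |T| := abs_pos.2 hT
  have hb : 0 < b := ha.trans_le hab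
  have key : ∀ u ∈ Set.uIoc (-1 : ℝ) 1, ‖∫ s in a..b, osc (fun s => T * q s + (ρ * u) * s) s *
      ((m s * s ^ 2 : ℝ) : ℂ)‖ ≤
      8 * (M * (b ^ 2 + 4 * b + 2)) * (2 * A) ^ 2 * (b - a) / (c * |T| / 2) ^ 2 := by
    intro u hu
    rw [Set.uIoc_of_le (by norm_num)] at hu
    have hu' : |u| ≤ 1 := abs_le.2 ⟨hu.1.le, hu.2⟩
    have hρu : |ρ * u| ≤ c * |T| / 2 := by
      rw [abs_mul]
      exact (mul_le_of_le_one_right (abs_nonneg _) hu').trans hρ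
    have hs0 : ∀ s ∈ Set.Icc a b, 0 < s := fun s hs => ha.trans_le hs.1
    have id1 : ∀ s : ℝ, HasDerivAt (fun s : ℝ => s ^ 2) (2 * s) s := fun s => by
      simpa using hasDerivAt_pow 2 s
    have id2 : ∀ s : ℝ, HasDerivAt (fun s : ℝ => 2 * s) 2 s := fun s => by
      simpa using (hasDerivAt_id s).const_mul 2
    have hs1 : ∀ s ∈ Set.Icc a b, s ^ 2 ≤ b ^ 2 := fun s hs =>
      pow_le_pow_left₀ (hs0 s hs).le hs.2 2
    -- The term `ρ * u` cancels at most half of `c * |T|`; halving the lower bound doubles `A`. The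
    -- factor `b² + 4b + 2` covers the derivatives of `s²`.
    refine norm_integral_osc_mul_le_of_nonstationary hab (l := c * |T| / 2) (A := 2 * A)
      (θ₁ := fun s => T * q₁ s + ρ * u) (θ₂ := fun s => T * q₂ s) (θ₃ := fun s => T * q₃ s)
      (h := fun s => m s * s ^ 2) (h₁ := fun s => m₁ s * s ^ 2 + m s * (2 * s))
      (h₂ := fun s => m₂ s * s ^ 2 + m₁ s * (2 * s) + (m₁ s * (2 * s) + m s * 2))
      (by positivity) (by linarith) (by positivity)
      ?_ ?_ ?_ ?_ ?_ ?_ ?_ (by simp [za]) (by simp [zb]) (by simp [za, za1]) (by simp [zb, zb1])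
      ?_ ?_ ?_ ?_ ?_ ?_
    · intro s hs
      exact (((d1 s hs).const_mul T).add ((hasDerivAt_id s).const_mul (ρ * u))).congr_deriv
        (by simp)
    · intro s hs
      exact ((d2 s hs).const_mul T).add_const _
    · intro s hs
      exact (d3 s hs).const_mul T
    · exact continuousOn_const.mul c3
    · intro s hs
      exact (dm s hs).mul (id1 s)
    · intro s hs
      exact ((dm1 s hs).mul (id1 s)).add ((dm s hs).mul (id2 s))
    · have k0 : ContinuousOn m (Set.Icc a b) :=
        fun s hs => (dm s hs).continuousAt.continuousWithinAt
      have k1 : ContinuousOn m₁ (Set.Icc a b) :=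
        fun s hs => (dm1 s hs).continuousAt.continuousWithinAt
      fun_prop
    · intro s hs
      have h1 : c * |T| ≤ |T * q₁ s| := by
        rw [abs_mul, mul_comm]
        exact mul_le_mul_of_nonneg_left ((b1 s hs).trans (le_abs_self _)) hT'.le
      have h2 := abs_sub_abs_le_abs_sub (T * q₁ s) (-(ρ * u))
      rw [abs_neg, sub_neg_eq_add] at h2
      linarith
    · intro s hs
      rw [abs_mul]
      calc |T| * |q₂ s| ≤ |T| * (A * c) := mul_le_mul_of_nonneg_left (b2 s hs) hT'.le
        _ = _ := by ring
    · intro s hs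
      rw [abs_mul]
      calc |T| * |q₃ s| ≤ |T| * (A * c) := mul_le_mul_of_nonneg_left (b3 s hs) hT'.le
        _ = _ := by ring
    · intro s hs
      rw [abs_mul, abs_of_nonneg (sq_nonneg s)]
      apply mul_le_mul (bm s hs) _ (sq_nonneg s) hM
      linarith [hs1 s hs]
    · intro s hs
      refine (abs_add_le _ _).trans ?_
      rw [abs_mul (m₁ s), abs_mul (m s), abs_of_nonneg (sq_nonneg s),
        abs_of_nonneg (by linarith [hs0 s hs] : 0 ≤ 2 * s)]
      have e1 := mul_le_mul (bm1 s hs) (hs1 s hs) (sq_nonneg s) hM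
      have e2 := mul_le_mul (bm s hs) (by linarith [hs.2] : 2 * s ≤ 2 * b)
        (by linarith [hs0 s hs]) hM
      have := mul_nonneg hM hb.le
      linarith
    · intro s hs
      refine ((abs_add_le _ _).trans (add_le_add (abs_add_le _ _) (abs_add_le _ _))).trans ?_
      rw [abs_mul (m₂ s), abs_mul (m₁ s), abs_mul (m s), abs_of_nonneg (sq_nonneg s),
        abs_of_nonneg (by linarith [hs0 s hs] : 0 ≤ 2 * s), abs_two]
      have e1 := mul_le_mul (bm2 s hs) (hs1 s hs) (sq_nonneg s) hM
      have e2 := mul_le_mul (bm1 s hs) (by linarith [hs.2] : 2 * s ≤ 2 * b)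
        (by linarith [hs0 s hs]) hM
      have e3 := bm s hs
      linarith
  refine (intervalIntegral.norm_integral_le_of_norm_le_const key).trans (le_of_eq ?_)
  have e : (c * |T| / 2) ^ 2 = c ^ 2 * T ^ 2 / 4 := by
    rw [div_pow, mul_pow, sq_abs]; norm_num
  rw [e]
  norm_num
  field_simp
  ring

/-- Trivial bound for a radial oscillatory integral. -/
lemma norm_radial_integral_le_trivial {a b M : ℝ} (ha : 0 < a) (hab : a ≤ b) (hM : 0 ≤ M)
    {m : ℝ → ℝ} (θ : ℝ → ℝ → ℝ) (bm : ∀ s ∈ Set.Icc a b, |m s| ≤ M) :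
    ‖∫ u in (-1 : ℝ)..1, ∫ s in a..b, osc (θ u) s * ((m s * s ^ 2 : ℝ) : ℂ)‖ ≤
      2 * M * b ^ 2 * (b - a) := by
  have key : ∀ u ∈ Set.uIoc (-1 : ℝ) 1, ‖∫ s in a..b, osc (θ u) s *
      ((m s * s ^ 2 : ℝ) : ℂ)‖ ≤ M * b ^ 2 * |b - a| := by
    intro u _
    apply intervalIntegral.norm_integral_le_of_norm_le_const
    intro s hs
    rw [Set.uIoc_of_le hab] at hs
    rw [norm_mul, norm_osc, one_mul, Complex.norm_real, Real.norm_eq_abs, abs_mul,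
      abs_of_nonneg (sq_nonneg s)]
    exact mul_le_mul (bm s ⟨hs.1.le, hs.2⟩) (pow_le_pow_left₀ (ha.trans hs.1).le hs.2 2)
      (sq_nonneg s) hM
  refine (intervalIntegral.norm_integral_le_of_norm_le_const key).trans (le_of_eq ?_)
  rw [abs_of_nonneg (sub_nonneg.2 hab)]
  norm_num
  ring

/-- Reduction of a radial oscillatory integral to one-dimensional ones. -/
lemma norm_radial_integral_le_div {a b D ρ : ℝ} (ha : 0 < a) (hab : a ≤ b) (hρ : 0 < ρ)
    {q m : ℝ → ℝ} (hq : Continuous q) (hm : Continuous m)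
    (hD : ∀ κ : ℝ, ‖∫ s in a..b, osc (fun s => q s + κ * s) s * ((m s * s : ℝ) : ℂ)‖ ≤ D) :
    ‖∫ u in (-1 : ℝ)..1, ∫ s in a..b, osc (fun s => q s + (ρ * u) * s) s *
      ((m s * s ^ 2 : ℝ) : ℂ)‖ ≤ 2 * D / ρ := by
  have hc : Continuous (Function.uncurry fun u s : ℝ =>
      osc (fun s => q s + (ρ * u) * s) s * ((m s * s ^ 2 : ℝ) : ℂ)) := by
    simp only [Function.uncurry_def, osc]
    fun_prop
  -- Integrating first in `u` divides by `iρs`: one power of `s` is used up, and the endpoints `u =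
  -- ±1` leave one-dimensional integrals with `κ = ±ρ`.
  rw [intervalIntegral_intervalIntegral_swap]
  · have inner : ∀ s ∈ Set.uIcc a b, ∫ u in (-1 : ℝ)..1, osc (fun s => q s + (ρ * u) * s) s *
        ((m s * s ^ 2 : ℝ) : ℂ) = (1 / (ρ * Complex.I)) *
        (osc (fun s => q s + ρ * s) s * ((m s * s : ℝ) : ℂ)
          - osc (fun s => q s + (-ρ) * s) s * ((m s * s : ℝ) : ℂ)) := by
      intro s hs
      rw [Set.uIcc_of_le hab] at hs
      have hs0 : (s : ℂ) ≠ 0 := by exact_mod_cast (ha.trans_le hs.1).ne'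
      have hρ0 : (ρ : ℂ) ≠ 0 := by exact_mod_cast hρ.ne'
      simp only [osc_add_mul]
      have e : ∀ u : ℝ, osc q s * Complex.exp (((ρ * u * s : ℝ) : ℂ) * Complex.I) *
          ((m s * s ^ 2 : ℝ) : ℂ) = (osc q s * ((m s * s ^ 2 : ℝ) : ℂ)) *
            Complex.exp ((ρ * s * Complex.I) * u) := by
        intro u
        rw [mul_right_comm]
        congr 2
        push_cast; ring
      simp only [e]
      rw [intervalIntegral.integral_const_mul, integral_exp_mul_complex (by
        simp [hs0, hρ0, Complex.I_ne_zero])]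
      have hI := Complex.I_ne_zero
      have e1 : Complex.exp ((ρ * s * Complex.I) * ((1 : ℝ) : ℂ)) =
        Complex.exp (((ρ * s : ℝ) : ℂ) * Complex.I) := by congr 1; push_cast; ring
      have e2 : Complex.exp ((ρ * s * Complex.I) * ((-1 : ℝ) : ℂ)) =
        Complex.exp (((-ρ * s : ℝ) : ℂ) * Complex.I) := by congr 1; push_cast; ring
      rw [e1, e2]
      push_cast
      field_simp
    rw [intervalIntegral.integral_congr inner, intervalIntegral.integral_const_mul,
      intervalIntegral.integral_sub, norm_mul]
    · have h1 := hD ρ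
      have h2 := hD (-ρ)
      have h3 : ‖(1 : ℂ) / (ρ * Complex.I)‖ = 1 / ρ := by
        simp [abs_of_pos hρ]
      rw [h3]
      calc _ ≤ 1 / ρ * (D + D) := mul_le_mul_of_nonneg_left
            ((norm_sub_le _ _).trans (add_le_add h1 h2)) (by positivity)
        _ = _ := by ring
    all_goals
      apply Continuous.intervalIntegrable
      unfold osc
      fun_prop
  · exact ((hc.continuousOn.integrableOn_compact
      (isCompact_uIcc.prod isCompact_uIcc)).mono_set
        (Set.prod_mono Set.uIoc_subset_uIcc Set.uIoc_subset_uIcc))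

/-- Second derivative test with an amplitude, off an exceptional interval. -/
lemma norm_integral_osc_mul_le_of_split {a b c d μ M M' : ℝ} (hac : a ≤ c) (hcd : c ≤ d)
    (hdb : d ≤ b) (hμ : 0 < μ) (hM : 0 ≤ M) {θ θ₁ θ₂ h h₁ : ℝ → ℝ}
    (d1 : ∀ s ∈ Set.Icc a b, HasDerivAt θ (θ₁ s) s)
    (d2 : ∀ s ∈ Set.Icc a b, HasDerivAt θ₁ (θ₂ s) s)
    (c2 : ContinuousOn θ₂ (Set.Icc a b))
    (hl : a < c → ∀ s ∈ Set.Icc a c, μ ≤ |θ₂ s|) (hr : d < b → ∀ s ∈ Set.Icc d b, μ ≤ |θ₂ s|)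
    (dh : ∀ s ∈ Set.Icc a b, HasDerivAt h (h₁ s) s) (ch : ContinuousOn h₁ (Set.Icc a b))
    (bh : ∀ s ∈ Set.Icc a b, |h s| ≤ M) (bh1 : ∀ s ∈ Set.Icc a b, |h₁ s| ≤ M)
    (bh' : ∀ s ∈ Set.Icc c d, |h s| ≤ M') :
    ‖∫ s in a..b, osc θ s * (h s : ℂ)‖ ≤ 20 / √μ * M * (1 + (b - a)) + M' * (d - c) := by
  have hab : a ≤ b := hac.trans (hcd.trans hdb)
  have c0 : ContinuousOn θ (Set.Icc a b) := fun s hs => (d1 s hs).continuousAt.continuousWithinAt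
  have k0 : ContinuousOn h (Set.Icc a b) := fun s hs => (dh s hs).continuousAt.continuousWithinAt
  have hi : ∀ x y, a ≤ x → x ≤ y → y ≤ b →
      IntervalIntegrable (fun s => osc θ s * (h s : ℂ)) volume x y := by
    intro x y hx hxy hy
    apply ContinuousOn.intervalIntegrable
    rw [Set.uIcc_of_le hxy]
    exact (c0.osc.mul (Complex.continuous_ofReal.comp_continuousOn k0)).mono
      (Set.Icc_subset_Icc hx hy)
  -- The lower bound is required only for `x < y`, so that the exceptional interval may reach an
  -- endpoint where `θ₂` is small.
  have outer : ∀ x y, a ≤ x → x ≤ y → y ≤ b → (x < y → ∀ s ∈ Set.Icc x y, μ ≤ |θ₂ s|) →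
      ‖∫ s in x..y, osc θ s * (h s : ℂ)‖ ≤ 10 / √μ * M * (1 + (b - a)) := by
    intro x y hx hxy hy hb
    have hnn : 0 ≤ 10 / √μ * M * (1 + (b - a)) := by
      have : 0 ≤ b - a := by linarith
      positivity
    rcases hxy.eq_or_lt with rfl | hlt
    · simpa using hnn
    have sub : Set.Icc x y ⊆ Set.Icc a b := Set.Icc_subset_Icc hx hy
    refine (norm_integral_osc_mul_le hxy (B := 10 / √μ) (c0.mono sub)
      (fun s hs => dh s (sub hs)) (ch.mono sub) ?_ (fun s hs => bh s (sub hs))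
      (fun s hs => bh1 s (sub hs))).trans ?_
    · intro z hz
      have sub' : Set.Icc x z ⊆ Set.Icc a b := (Set.Icc_subset_Icc_right hz.2).trans sub
      exact norm_integral_osc_le_of_le_abs_deriv2 hz.1 hμ (fun s hs => d1 s (sub' hs))
        (fun s hs => d2 s (sub' hs)) (c2.mono sub')
        fun s hs => hb hlt s ⟨hs.1, hs.2.trans hz.2⟩
    · apply mul_le_mul_of_nonneg_left (by linarith) (by positivity)
  rw [← intervalIntegral.integral_add_adjacent_intervals (hi a c le_rfl hac (hcd.trans hdb))
    (hi c b hac (hcd.trans hdb) le_rfl),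
    ← intervalIntegral.integral_add_adjacent_intervals (hi c d hac hcd hdb)
    (hi d b (hac.trans hcd) hdb le_rfl)]
  have n1 := outer a c le_rfl hac (hcd.trans hdb) hl
  have n3 := outer d b (hac.trans hcd) hdb le_rfl hr
  have n2 : ‖∫ s in c..d, osc θ s * (h s : ℂ)‖ ≤ M' * |d - c| := by
    apply intervalIntegral.norm_integral_le_of_norm_le_const
    intro s hs
    rw [Set.uIoc_of_le hcd] at hs
    rw [norm_mul, norm_osc, one_mul, Complex.norm_real]
    exact bh' s ⟨hs.1.le, hs.2⟩
  rw [abs_of_nonneg (sub_nonneg.2 hcd)] at n2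
  refine (norm_add_le _ _).trans ((add_le_add n1 ((norm_add_le _ _).trans
    (add_le_add n2 n3))).trans (le_of_eq ?_))
  ring

/-! ### The rescaled dispersion relations and their derivatives. -/

/-- The square of `phase`. -/
noncomputable def phaseSq (σ α β s : ℝ) : ℝ := α * s ^ 2 + β * s ^ (2 - σ)

/-- The rescaled dispersion relations `(α s² + β s^(2-σ))^(1/2)`. -/
noncomputable def phase (σ α β s : ℝ) : ℝ := √(phaseSq σ α β s)

/-- First derivative of `phase`. -/
noncomputable def phase₁ (σ α β s : ℝ) : ℝ :=
  (2 * α * s + β * ((2 - σ) * s ^ (1 - σ))) / (2 * phase σ α β s)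

/-- Second derivative of `phase`. -/
noncomputable def phase₂ (σ α β s : ℝ) : ℝ :=
  ((2 * α + β * ((2 - σ) * ((1 - σ) * s ^ (-σ)))) / 2 - phase₁ σ α β s ^ 2) / phase σ α β s

/-- Third derivative of `phase`. -/
noncomputable def phase₃ (σ α β s : ℝ) : ℝ :=
  (β * ((2 - σ) * ((1 - σ) * (-σ * s ^ (-σ - 1)))) / 2 - 3 * phase₁ σ α β s * phase₂ σ α β s) /
    phase σ α β s

/-- The admissible parameters of `phase`. -/
def PhaseParam (α β : ℝ) : Prop := 0 ≤ α ∧ α ≤ 1 ∧ 0 ≤ β ∧ β ≤ 1 ∧ 1 ≤ α + β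

section Phase

variable {σ α β s : ℝ}

/-- The condition `1 ≤ α + β` prevents both parameters from vanishing together; either one alone may
vanish, which admits the limits of low and high frequency. -/
lemma PhaseParam.linear_pos (h : PhaseParam α β) {x y : ℝ} (hx : 0 < x) (hy : 0 < y) :
    0 < α * x + β * y := by
  obtain ⟨h1, h2, h3, h4, h5⟩ := h
  rcases h1.eq_or_lt with h0 | h0
  · have : 0 < β := by linarith
    have := mul_nonneg h1 hx.le
    positivity
  · have := mul_nonneg h3 hy.le
    positivity

lemma phaseSq_pos (h : PhaseParam α β) (hs : 0 < s) : 0 < phaseSq σ α β s :=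
  h.linear_pos (by positivity) (Real.rpow_pos_of_pos hs _)

lemma phase_pos (h : PhaseParam α β) (hs : 0 < s) : 0 < phase σ α β s :=
  Real.sqrt_pos.2 (phaseSq_pos h hs)

lemma phase_sq (h : PhaseParam α β) (hs : 0 < s) : phase σ α β s ^ 2 = phaseSq σ α β s :=
  Real.sq_sqrt (phaseSq_pos h hs).le

lemma phase₁_pos (h : PhaseParam α β) (hσ : σ < 2) (hs : 0 < s) : 0 < phase₁ σ α β s := by
  apply div_pos _ (mul_pos two_pos (phase_pos h hs))
  have := h.linear_pos (x := 2 * s) (y := (2 - σ) * s ^ (1 - σ)) (by positivity)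
    (mul_pos (by linarith) (Real.rpow_pos_of_pos hs _))
  linarith

lemma hasDerivAt_phaseSq (hs : 0 < s) : HasDerivAt (phaseSq σ α β)
    (2 * α * s + β * ((2 - σ) * s ^ (1 - σ))) s := by
  have h1 := (hasDerivAt_pow 2 s).const_mul α
  have h2 := (Real.hasDerivAt_rpow_const (x := s) (p := 2 - σ) (.inl hs.ne')).const_mul β
  refine (h1.add h2).congr_deriv ?_
  rw [show 2 - σ - 1 = 1 - σ by ring]
  norm_num
  ring

lemma hasDerivAt_phaseSq₁ (hs : 0 < s) : HasDerivAt
    (fun s : ℝ => 2 * α * s + β * ((2 - σ) * s ^ (1 - σ)))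
    (2 * α + β * ((2 - σ) * ((1 - σ) * s ^ (-σ)))) s := by
  have h1 := (hasDerivAt_id s).const_mul (2 * α)
  have h2 := ((Real.hasDerivAt_rpow_const (x := s) (p := 1 - σ)
    (.inl hs.ne')).const_mul (2 - σ)).const_mul β
  refine (h1.add h2).congr_deriv ?_
  rw [show 1 - σ - 1 = -σ by ring]
  ring

lemma hasDerivAt_phaseSq₂ (hs : 0 < s) : HasDerivAt
    (fun s : ℝ => 2 * α + β * ((2 - σ) * ((1 - σ) * s ^ (-σ))))
    (β * ((2 - σ) * ((1 - σ) * (-σ * s ^ (-σ - 1))))) s := by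
  have h2 := (((Real.hasDerivAt_rpow_const (x := s) (p := -σ)
    (.inl hs.ne')).const_mul (1 - σ)).const_mul (2 - σ)).const_mul β
  exact h2.const_add _

lemma hasDerivAt_phase (h : PhaseParam α β) (hs : 0 < s) :
    HasDerivAt (phase σ α β) (phase₁ σ α β s) s :=
  (hasDerivAt_phaseSq hs).sqrt (phaseSq_pos h hs).ne'

lemma hasDerivAt_phase₁ (h : PhaseParam α β) (hs : 0 < s) :
    HasDerivAt (phase₁ σ α β) (phase₂ σ α β s) s := by
  have hp := phase_pos (σ := σ) h hs
  refine ((hasDerivAt_phaseSq₁ hs).div ((hasDerivAt_phase h hs).const_mul 2)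
    (by positivity)).congr_deriv ?_
  have e : 2 * α * s + β * ((2 - σ) * s ^ (1 - σ)) = phase₁ σ α β s * (2 * phase σ α β s) := by
    rw [phase₁, div_mul_cancel₀ _ (by positivity)]
  simp only [e, phase₂]
  field_simp

lemma hasDerivAt_phase₂ (h : PhaseParam α β) (hs : 0 < s) :
    HasDerivAt (phase₂ σ α β) (phase₃ σ α β s) s := by
  have hp := phase_pos (σ := σ) h hs
  refine ((((hasDerivAt_phaseSq₂ hs).div_const 2).sub ((hasDerivAt_phase₁ h hs).pow 2)).div
    (hasDerivAt_phase h hs) hp.ne').congr_deriv ?_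
  have e : (2 * α + β * ((2 - σ) * ((1 - σ) * s ^ (-σ)))) / 2 - phase₁ σ α β s ^ 2
      = phase₂ σ α β s * phase σ α β s := by
    rw [phase₂, div_mul_cancel₀ _ hp.ne']
  simp only [Pi.sub_apply, Pi.pow_apply, e, phase₃]
  field_simp
  norm_num
  ring

lemma continuousOn_phase₃ (h : PhaseParam α β) : ContinuousOn (phase₃ σ α β) (Set.Ioi 0) := by
  have h0 : ContinuousOn (phase σ α β) (Set.Ioi 0) := fun s hs =>
    (hasDerivAt_phase h hs).continuousAt.continuousWithinAt
  have h1 : ContinuousOn (phase₁ σ α β) (Set.Ioi 0) := fun s hs =>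
    (hasDerivAt_phase₁ h hs).continuousAt.continuousWithinAt
  have h2 : ContinuousOn (phase₂ σ α β) (Set.Ioi 0) := fun s hs =>
    (hasDerivAt_phase₂ h hs).continuousAt.continuousWithinAt
  have h3 : ContinuousOn (fun s : ℝ => s ^ (-σ - 1)) (Set.Ioi 0) :=
    continuousOn_id.rpow_const fun s hs => .inl (ne_of_gt hs)
  unfold phase₃
  exact ContinuousOn.div (by fun_prop) h0 fun s hs => (phase_pos h hs).ne'

lemma continuous_phase (hσ : σ < 2) : Continuous (phase σ α β) := by
  have : Continuous fun s : ℝ => s ^ (2 - σ) := Real.continuous_rpow_const (by linarith)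
  unfold phase phaseSq
  fun_prop

/-- Bounds for the derivatives of `phase`, uniform in the parameters. -/
lemma exists_phase_bounds (hσ : σ < 2) {a b : ℝ} (ha : 0 < a) :
    ∃ c A : ℝ, 0 < c ∧ 1 ≤ A ∧ ∀ α β, PhaseParam α β → ∀ s ∈ Set.Icc a b,
      c ≤ phase₁ σ α β s ∧ |phase₂ σ α β s| ≤ A * c ∧ |phase₃ σ α β s| ≤ A * c ∧
        phase σ α β s ≤ A := by
  -- On this compact set `phase` and `phase₁` do not vanish, so everything is continuous in
  -- parameters and variable jointly. The lower bound for `phase₁` comes from an upper bound for its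
  -- reciprocal.
  set K : Set (ℝ × ℝ × ℝ) := {p | PhaseParam p.1 p.2.1 ∧ p.2.2 ∈ Set.Icc a b} with hK
  have hKc : IsCompact K := by
    apply (isCompact_Icc.prod (isCompact_Icc.prod isCompact_Icc) :
      IsCompact (Set.Icc (0 : ℝ) 1 ×ˢ Set.Icc (0 : ℝ) 1 ×ˢ Set.Icc a b)).of_isClosed_subset
    · have h1 : IsClosed {p : ℝ × ℝ × ℝ | 0 ≤ p.1} := isClosed_le (by fun_prop) (by fun_prop)
      have h2 : IsClosed {p : ℝ × ℝ × ℝ | p.1 ≤ 1} := isClosed_le (by fun_prop) (by fun_prop)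
      have h3 : IsClosed {p : ℝ × ℝ × ℝ | 0 ≤ p.2.1} := isClosed_le (by fun_prop) (by fun_prop)
      have h4 : IsClosed {p : ℝ × ℝ × ℝ | p.2.1 ≤ 1} := isClosed_le (by fun_prop) (by fun_prop)
      have h5 : IsClosed {p : ℝ × ℝ × ℝ | 1 ≤ p.1 + p.2.1} :=
        isClosed_le (by fun_prop) (by fun_prop)
      have h6 : IsClosed {p : ℝ × ℝ × ℝ | p.2.2 ∈ Set.Icc a b} :=
        isClosed_Icc.preimage (by fun_prop)
      exact (h1.inter (h2.inter (h3.inter (h4.inter h5)))).inter h6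
    · rintro p ⟨⟨h1, h2, h3, h4, h5⟩, h6⟩
      exact ⟨⟨h1, h2⟩, ⟨h3, h4⟩, h6⟩
  have hpos : ∀ p ∈ K, 0 < p.2.2 := fun p hp => ha.trans_le hp.2.1
  have cr : ∀ e : ℝ, ContinuousOn (fun p : ℝ × ℝ × ℝ => p.2.2 ^ e) K := fun e =>
    (continuous_snd.comp continuous_snd).continuousOn.rpow_const fun p hp =>
      .inl (hpos p hp).ne'
  have r1 := cr (1 - σ)
  have r2 := cr (-σ)
  have r3 := cr (-σ - 1)
  have c0 : ContinuousOn (fun p : ℝ × ℝ × ℝ => phase σ p.1 p.2.1 p.2.2) K := by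
    have := cr (2 - σ)
    unfold phase phaseSq
    fun_prop
  have hp0 : ∀ p ∈ K, phase σ p.1 p.2.1 p.2.2 ≠ 0 := fun p hp => (phase_pos hp.1 (hpos p hp)).ne'
  have c1 : ContinuousOn (fun p : ℝ × ℝ × ℝ => phase₁ σ p.1 p.2.1 p.2.2) K := by
    unfold phase₁
    exact ContinuousOn.div (by fun_prop) (by fun_prop) fun p hp => mul_ne_zero two_ne_zero (hp0 p hp)
  have c2 : ContinuousOn (fun p : ℝ × ℝ × ℝ => phase₂ σ p.1 p.2.1 p.2.2) K := by
    unfold phase₂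
    exact ContinuousOn.div (by fun_prop) (by fun_prop) fun p hp => hp0 p hp
  have c3 : ContinuousOn (fun p : ℝ × ℝ × ℝ => phase₃ σ p.1 p.2.1 p.2.2) K := by
    unfold phase₃
    exact ContinuousOn.div (by fun_prop) (by fun_prop) fun p hp => hp0 p hp
  have ci : ContinuousOn (fun p : ℝ × ℝ × ℝ => 1 / phase₁ σ p.1 p.2.1 p.2.2) K :=
    continuousOn_const.div c1 fun p hp => (phase₁_pos hp.1 hσ (hpos p hp)).ne'
  obtain ⟨B0, hB0⟩ := hKc.exists_bound_of_continuousOn c0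
  obtain ⟨Bi, hBi⟩ := hKc.exists_bound_of_continuousOn ci
  obtain ⟨B2, hB2⟩ := hKc.exists_bound_of_continuousOn c2
  obtain ⟨B3, hB3⟩ := hKc.exists_bound_of_continuousOn c3
  have hc : 0 < |Bi| + 1 := by positivity
  refine ⟨1 / (|Bi| + 1), (1 + |B0| + |B2| + |B3|) * (|Bi| + 1), by positivity, ?_, ?_⟩
  · have h1 : 1 ≤ 1 + |B0| + |B2| + |B3| := by
      linarith [abs_nonneg B0, abs_nonneg B2, abs_nonneg B3]
    have h2 : 1 ≤ |Bi| + 1 := by linarith [abs_nonneg Bi]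
    nlinarith
  intro α β h s hs
  have hmem : (α, β, s) ∈ K := ⟨h, hs⟩
  have e0 := hB0 _ hmem
  have ei := hBi _ hmem
  have e2 := hB2 _ hmem
  have e3 := hB3 _ hmem
  simp only [Real.norm_eq_abs] at e0 ei e2 e3
  have h1 := phase₁_pos h hσ (ha.trans_le hs.1)
  have n0 := abs_nonneg B0
  have n2 := abs_nonneg B2
  have n3 := abs_nonneg B3
  have ni := abs_nonneg Bi
  refine ⟨?_, ?_, ?_, ?_⟩
  · rw [abs_of_pos (by positivity)] at ei
    rw [div_le_iff₀ hc]
    rw [div_le_iff₀ h1] at ei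
    nlinarith [le_abs_self Bi]
  · rw [mul_assoc, mul_one_div_cancel hc.ne']
    linarith [le_abs_self B2]
  · rw [mul_assoc, mul_one_div_cancel hc.ne']
    linarith [le_abs_self B3]
  · have : phase σ α β s ≤ |B0| := (le_abs_self _).trans (e0.trans (le_abs_self _))
    nlinarith

/-- With `f = phase²` the left side is `2 f f'' - f'²`, in which the `α²` terms cancel, so `β`
factors out. For `α = β = 1` the remaining bracket vanishes exactly at the degenerate point. -/
lemma phase₂_mul_eq (hσ : 1 < σ) (h : PhaseParam α β) (hs : 0 < s) :
    phase₂ σ α β s * (4 * phase σ α β s ^ 3) =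
      2 * σ * (σ - 1) * (β * s ^ (2 - 2 * σ) * (α * s ^ σ - β * ((2 - σ) / (2 * (σ - 1))))) := by
  have hp := phase_pos (σ := σ) h hs
  have hsq := phase_sq (σ := σ) h hs
  have hσ' : σ - 1 ≠ 0 := by linarith
  set X := s ^ (-σ) with hX
  have x0 : s ^ σ = X⁻¹ := by rw [hX, Real.rpow_neg hs.le, inv_inv]
  have hX0 : 0 < X := Real.rpow_pos_of_pos hs _
  have x2 : s ^ (2 - σ) = s ^ 2 * X := by
    rw [sub_eq_add_neg, Real.rpow_add hs, Real.rpow_two]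
  have x1 : s ^ (1 - σ) = s * X := by
    rw [sub_eq_add_neg, Real.rpow_add hs, Real.rpow_one]
  have x3 : s ^ (2 - 2 * σ) = s ^ 2 * X ^ 2 := by
    rw [show 2 - 2 * σ = 2 + (-σ + -σ) by ring, Real.rpow_add hs, Real.rpow_add hs, Real.rpow_two]
    ring
  rw [phaseSq, x2] at hsq
  have e1 : phase₁ σ α β s ^ 2 * (4 * phase σ α β s ^ 2) =
      (2 * α * s + β * ((2 - σ) * (s * X))) ^ 2 := by
    rw [phase₁, x1]
    field_simp
    ring
  have e2 : phase₂ σ α β s * (4 * phase σ α β s ^ 3) =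
      2 * (2 * α + β * ((2 - σ) * ((1 - σ) * X))) * phase σ α β s ^ 2 -
        phase₁ σ α β s ^ 2 * (4 * phase σ α β s ^ 2) := by
    rw [phase₂, ← hX]
    field_simp
    ring
  rw [e2, e1, hsq, x3, x0]
  field_simp
  ring

/-- Lower bound for the second derivative of `phase`. -/
lemma exists_le_abs_phase₂ (hσ : 1 < σ) (hσ₂ : σ < 2) {a b : ℝ} (ha : 0 < a) (hb : 0 < b) :
    ∃ c : ℝ, 0 < c ∧ ∀ α β, PhaseParam α β → ∀ s ∈ Set.Icc a b,
      c * (β * |α * s ^ σ - β * ((2 - σ) / (2 * (σ - 1)))|) ≤ |phase₂ σ α β s| := by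
  obtain ⟨c, A, hc, hA, H⟩ := exists_phase_bounds (σ := σ) (b := b) hσ₂ ha
  have hb2 : 0 < b ^ (2 - 2 * σ) := Real.rpow_pos_of_pos hb _
  have hσ' : 0 < σ - 1 := by linarith
  -- `A` bounds `phase` from above, and `s ^ (2 - 2σ)` is smallest at `b` because the exponent is
  -- negative.
  refine ⟨2 * σ * (σ - 1) * b ^ (2 - 2 * σ) / (4 * A ^ 3), by positivity, ?_⟩
  intro α β h s hs
  have hs0 : 0 < s := ha.trans_le hs.1
  have hp := phase_pos (σ := σ) h hs0
  have e := congrArg abs (phase₂_mul_eq hσ h hs0)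
  rw [abs_mul, abs_of_pos (by positivity : 0 < 4 * phase σ α β s ^ 3), abs_mul (2 * σ * (σ - 1)),
    abs_mul (β * s ^ (2 - 2 * σ)),
    abs_of_pos (by positivity : 0 < 2 * σ * (σ - 1)), abs_mul β, abs_of_nonneg h.2.2.1,
    abs_of_pos (Real.rpow_pos_of_pos hs0 _)] at e
  have h1 : phase σ α β s ^ 3 ≤ A ^ 3 := pow_le_pow_left₀ hp.le (H α β h s hs).2.2.2 3
  have h2 : b ^ (2 - 2 * σ) ≤ s ^ (2 - 2 * σ) :=
    Real.rpow_le_rpow_of_nonpos hs0 hs.2 (by linarith)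
  rw [div_mul_eq_mul_div, div_le_iff₀ (by positivity)]
  calc _ = 2 * σ * (σ - 1) * (β * b ^ (2 - 2 * σ) *
        |α * s ^ σ - β * ((2 - σ) / (2 * (σ - 1)))|) := by ring
    _ ≤ 2 * σ * (σ - 1) * (β * s ^ (2 - 2 * σ) *
        |α * s ^ σ - β * ((2 - σ) / (2 * (σ - 1)))|) := by
      have := h.2.2.1
      gcongr
    _ = |phase₂ σ α β s| * (4 * phase σ α β s ^ 3) := e.symm
    _ ≤ _ := by gcongr

end Phase

/-! ### Amplitudes and uniform bounds for radial integrals. -/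

/-- `C²` amplitudes supported in `[a, b]`, with the derivatives up to order two bounded by `M`. -/
structure IsAmplitude (a b M : ℝ) (m : ℝ → ℝ) : Prop where
  contDiff : ContDiff ℝ 2 m
  eq_zero : ∀ s, s ∉ Set.Icc a b → m s = 0
  bound : ∀ s, |m s| ≤ M
  bound_deriv : ∀ s, |deriv m s| ≤ M
  bound_deriv_deriv : ∀ s, |deriv (deriv m) s| ≤ M

namespace IsAmplitude

variable {a b M : ℝ} {m : ℝ → ℝ}

lemma nonneg (h : IsAmplitude a b M m) : 0 ≤ M := (abs_nonneg _).trans (h.bound 0)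

lemma contDiff_deriv (h : IsAmplitude a b M m) : ContDiff ℝ 1 (deriv m) :=
  ((contDiff_succ_iff_deriv (n := 1)).1 h.contDiff).2.2

lemma hasDerivAt (h : IsAmplitude a b M m) (s : ℝ) : HasDerivAt m (deriv m s) s :=
  (h.contDiff.differentiable two_ne_zero s).hasDerivAt

lemma hasDerivAt_deriv (h : IsAmplitude a b M m) (s : ℝ) :
    HasDerivAt (deriv m) (deriv (deriv m) s) s :=
  (h.contDiff_deriv.differentiable one_ne_zero s).hasDerivAt

lemma continuous_deriv_deriv (h : IsAmplitude a b M m) : Continuous (deriv (deriv m)) :=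
  h.contDiff_deriv.continuous_deriv le_rfl

/-- Continuity forces the value zero at the endpoints; this removes the boundary terms in the
integrations by parts. -/
lemma eq_zero_left_right {f : ℝ → ℝ} (hf : Continuous f) (h : ∀ s, s ∉ Set.Icc a b → f s = 0) :
    f a = 0 ∧ f b = 0 := by
  have hc : IsClosed {s | f s = 0} := isClosed_eq hf continuous_const
  have h1 : Set.Iio a ⊆ {s | f s = 0} := fun s hs => h s fun h' => not_lt.2 h'.1 hs
  have h2 : Set.Ioi b ⊆ {s | f s = 0} := fun s hs => h s fun h' => not_lt.2 h'.2 hs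
  refine ⟨closure_minimal h1 hc ?_, closure_minimal h2 hc ?_⟩
  · rw [closure_Iio]; exact Set.self_mem_Iic
  · rw [closure_Ioi]; exact Set.self_mem_Ici

lemma deriv_eq_zero (h : IsAmplitude a b M m) (s : ℝ) (hs : s ∉ Set.Icc a b) : deriv m s = 0 := by
  have : m =ᶠ[nhds s] fun _ => 0 := by
    filter_upwards [isClosed_Icc.isOpen_compl.mem_nhds hs] with x hx using h.eq_zero x hx
  rw [this.deriv_eq, deriv_const]

lemma continuous (h : IsAmplitude a b M m) : Continuous m := h.contDiff.continuous

end IsAmplitude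

/-- Combining the trivial bound with the nonstationary decay `T⁻²` gives every intermediate rate;
the rates `4/3` and `3/2` are needed. -/
lemma min_one_le_rpow {x p : ℝ} (hx : 0 < x) (hp : 0 ≤ p) (hp2 : p ≤ 2) :
    min 1 (1 / x ^ 2) ≤ x ^ (-p) := by
  rcases le_total x 1 with h | h
  · refine (min_le_left _ _).trans ?_
    exact Real.one_le_rpow_of_pos_of_le_one_of_nonpos hx h (by linarith)
  · refine (min_le_right _ _).trans ?_
    rw [one_div, ← Real.rpow_natCast, ← Real.rpow_neg hx.le]
    exact Real.rpow_le_rpow_of_exponent_le h (by push_cast; linarith)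

/-- Uniform bound for radial oscillatory integrals with the phases `phase`. -/
lemma exists_radial_integral_bound {σ a b : ℝ} (hσ : σ < 2) (ha : 0 < a) (hab : a ≤ b) :
    ∃ C : ℝ, 0 < C ∧ ∀ α β, PhaseParam α β → ∀ (M : ℝ) (m : ℝ → ℝ), IsAmplitude a b M m →
      ∀ T : ℝ, T ≠ 0 → ∀ D : ℝ,
      (∀ κ : ℝ, ‖∫ s in a..b, osc (fun s => T * phase σ α β s + κ * s) s *
        ((m s * s : ℝ) : ℂ)‖ ≤ D) → ∀ ρ : ℝ, 0 ≤ ρ →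
      ‖∫ u in (-1 : ℝ)..1, ∫ s in a..b, osc (fun s => T * phase σ α β s + (ρ * u) * s) s *
        ((m s * s ^ 2 : ℝ) : ℂ)‖ ≤ C * (M * min 1 (1 / |T| ^ 2) + D / |T|) := by
  obtain ⟨c, A, hc, hA, H⟩ := exists_phase_bounds (σ := σ) (b := b) hσ ha
  have hb : 0 < b := ha.trans_le hab
  have hba : 0 ≤ b - a := sub_nonneg.2 hab
  set C1 := 2 * b ^ 2 * (b - a) with hC1
  set C2 := 256 * (b ^ 2 + 4 * b + 2) * A ^ 2 * (b - a) / c ^ 2 with hC2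
  have p1 : 0 ≤ C1 := by positivity
  have p2 : 0 ≤ C2 := by positivity
  have p3 : 0 < 4 / c := by positivity
  refine ⟨C1 + C2 + 4 / c, by positivity, ?_⟩
  intro α β hp M m hm T hT D hD ρ hρ
  have hT' : 0 < |T| := abs_pos.2 hT
  have hD0 : 0 ≤ D := (norm_nonneg _).trans (hD 0)
  have hM := hm.nonneg
  have hpos : ∀ s ∈ Set.Icc a b, 0 < s := fun s hs => ha.trans_le hs.1
  -- Below the threshold the phase has no stationary point; above it the factor `1/ρ` is at most
  -- `2/(c|T|)`.
  by_cases hsmall : ρ ≤ c * |T| / 2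
  · have t1 := norm_radial_integral_le_trivial ha hab hM
      (fun u s => T * phase σ α β s + (ρ * u) * s) fun s _ => hm.bound s
    obtain ⟨za, zb⟩ := IsAmplitude.eq_zero_left_right hm.continuous hm.eq_zero
    obtain ⟨za1, zb1⟩ := IsAmplitude.eq_zero_left_right hm.contDiff_deriv.continuous
      hm.deriv_eq_zero
    have t2 := norm_radial_integral_le_of_nonstationary ha hab hc hA hM hT
      (by rwa [abs_of_nonneg hρ]) (fun s hs => hasDerivAt_phase (σ := σ) hp (hpos s hs))
      (fun s hs => hasDerivAt_phase₁ hp (hpos s hs)) (fun s hs => hasDerivAt_phase₂ hp (hpos s hs))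
      ((continuousOn_phase₃ hp).mono hpos) (fun s _ => hm.hasDerivAt s)
      (fun s _ => hm.hasDerivAt_deriv s) hm.continuous_deriv_deriv.continuousOn za zb za1 zb1
      (fun s hs => (H α β hp s hs).1) (fun s hs => (H α β hp s hs).2.1)
      (fun s hs => (H α β hp s hs).2.2.1) (fun s _ => hm.bound s) (fun s _ => hm.bound_deriv s)
      fun s _ => hm.bound_deriv_deriv s
    rcases le_total 1 (1 / |T| ^ 2) with h | h
    · rw [min_eq_left h]
      calc _ ≤ 2 * M * b ^ 2 * (b - a) := t1
        _ = C1 * (M * 1) := by rw [hC1]; ring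
        _ ≤ _ := by
          apply mul_le_mul _ _ (by positivity) (by positivity)
          · linarith
          · have : 0 ≤ D / |T| := by positivity
            linarith
    · rw [min_eq_right h]
      rw [← sq_abs T] at t2
      calc _ ≤ _ := t2
        _ = C2 * (M * (1 / |T| ^ 2)) := by rw [hC2]; ring
        _ ≤ _ := by
          apply mul_le_mul _ _ (by positivity) (by positivity)
          · linarith
          · have : 0 ≤ D / |T| := by positivity
            linarith
  · push Not at hsmall
    have hρ0 : 0 < c * |T| / 2 := by positivity
    have t := norm_radial_integral_le_div ha hab (hρ0.trans hsmall)
      ((continuous_phase (σ := σ) (α := α) (β := β) hσ).const_mul T) hm.continuous hD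
    calc _ ≤ 2 * D / ρ := t
      _ ≤ 2 * D / (c * |T| / 2) := by gcongr
      _ = 4 / c * (D / |T|) := by field_simp; ring
      _ ≤ _ := by
        apply mul_le_mul _ _ (by positivity) (by positivity)
        · linarith
        · have : 0 ≤ M * min 1 (1 / |T| ^ 2) := by positivity
          linarith

/-! ### Pointwise kernel bounds. -/

lemma continuous_dispersion {σ : ℝ} (hσ : σ < 2) : Continuous (dispersion σ) := by
  have : Continuous fun s : ℝ => s ^ (2 - σ) := Real.continuous_rpow_const (by linarith)
  unfold dispersion
  fun_prop

/-- The inverse Fourier transform of a localized propagator, rescaled to frequency one. -/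
lemma fourierInv_propagator {σ α β t T N a b : ℝ} (hσ : σ < 2) (hN : 0 < N) (ha : 0 < a)
    (hab : a ≤ b) {μ : ℝ → ℝ} (hμ : Continuous μ) (h0 : ∀ s, s ∉ Set.Icc a b → μ (N * s) = 0)
    (hT : ∀ s, 0 < s → t * dispersion σ (N * s) = T * phase σ α β s) (w : R3) :
    𝓕⁻ (fun y : R3 => Complex.exp (Complex.I *
        ((t * dispersion σ ‖(2 * Real.pi) • y‖ : ℝ) : ℂ)) * (μ ‖(2 * Real.pi) • y‖ : ℂ)) w =
      2 * Real.pi * (N / (2 * Real.pi) : ℝ) ^ 3 * ∫ u in (-1 : ℝ)..1, ∫ s in a..b,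
        osc (fun s => T * phase σ α β s + (N * ‖w‖ * u) * s) s * ((μ (N * s) * s ^ 2 : ℝ) : ℂ) := by
  have hpi := Real.pi_pos
  -- From `2π‖y‖ = N s`: the radial variable of the integral is `‖y‖ = k s`.
  set k : ℝ := N / (2 * Real.pi) with hk
  have hk0 : 0 < k := by positivity
  have hNk : N = 2 * Real.pi * k := by rw [hk]; field_simp
  set g : ℝ → ℂ := fun r => Complex.exp (Complex.I *
    ((t * dispersion σ (2 * Real.pi * r) : ℝ) : ℂ)) * (μ (2 * Real.pi * r) : ℂ) with hg
  have hgc : Continuous g := by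
    have := continuous_dispersion hσ
    simp only [hg]
    fun_prop
  have hg0 : ∀ r, r ∉ Set.Icc (k * a) (k * b) → g r = 0 := by
    intro r hr
    have hr' : r / k ∉ Set.Icc a b := by
      intro h
      apply hr
      rw [Set.mem_Icc, le_div_iff₀ hk0, div_le_iff₀ hk0] at h
      exact ⟨by linarith [h.1], by linarith [h.2]⟩
    have := h0 _ hr'
    rw [show N * (r / k) = 2 * Real.pi * r by rw [hNk]; field_simp] at this
    simp [hg, this]
  have e : (fun y : R3 => Complex.exp (Complex.I *
        ((t * dispersion σ ‖(2 * Real.pi) • y‖ : ℝ) : ℂ)) * (μ ‖(2 * Real.pi) • y‖ : ℂ)) =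
      fun y => g ‖y‖ := by
    ext y
    rw [norm_smul, Real.norm_of_nonneg (by positivity)]
  rw [e, fourierInv_radial (by positivity) (mul_le_mul_of_nonneg_left hab hk0.le) hgc hg0,
    mul_assoc (2 * Real.pi : ℂ) ((k : ℂ) ^ 3)]
  congr 1
  rw [← intervalIntegral.integral_const_mul]
  apply intervalIntegral.integral_congr
  intro u _
  simp only
  have cv := intervalIntegral.integral_comp_mul_left (a := a) (b := b)
    (fun r : ℝ => Complex.exp (((2 * Real.pi * ‖w‖ * r * u : ℝ) : ℂ) * Complex.I) *
      ((r : ℂ) ^ 2 * g r)) hk0.ne'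
  have cv' : ∫ r in (k * a)..(k * b),
      Complex.exp (((2 * Real.pi * ‖w‖ * r * u : ℝ) : ℂ) * Complex.I) * ((r : ℂ) ^ 2 * g r) =
      (k : ℂ) * ∫ s in a..b, Complex.exp (((2 * Real.pi * ‖w‖ * (k * s) * u : ℝ) : ℂ) * Complex.I) *
        (((k * s : ℝ) : ℂ) ^ 2 * g (k * s)) := by
    rw [cv, Complex.real_smul, ← mul_assoc, ← Complex.ofReal_mul, mul_inv_cancel₀ hk0.ne',
      Complex.ofReal_one, one_mul]
  rw [cv', ← intervalIntegral.integral_const_mul, ← intervalIntegral.integral_const_mul]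
  apply intervalIntegral.integral_congr
  intro s hs
  rw [Set.uIcc_of_le hab] at hs
  have hd := hT s (ha.trans_le hs.1)
  have hgs : g (k * s) = osc (fun s => T * phase σ α β s) s * (μ (N * s) : ℂ) := by
    simp only [hg, osc]
    rw [show 2 * Real.pi * (k * s) = N * s by rw [hNk]; ring, hd, mul_comm Complex.I]
  simp only [hgs, osc_add_mul (fun s => T * phase σ α β s)]
  rw [show 2 * Real.pi * ‖w‖ * (k * s) * u = N * ‖w‖ * u * s by rw [hNk]; ring]
  push_cast
  ring

/-- Kernel bound deduced from one-dimensional bounds. -/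
lemma exists_kernel_bound {σ a b : ℝ} (hσ : σ < 2) (ha : 0 < a) (hab : a ≤ b) :
    ∃ C : ℝ, 0 < C ∧ ∀ α β, PhaseParam α β → ∀ (M N t T : ℝ) (μ : ℝ → ℝ), 0 < N →
      IsAmplitude a b M (fun s => μ (N * s)) → Continuous μ → T ≠ 0 →
      (∀ s, 0 < s → t * dispersion σ (N * s) = T * phase σ α β s) → ∀ D : ℝ,
      (∀ κ : ℝ, ‖∫ s in a..b, osc (fun s => T * phase σ α β s + κ * s) s *
        ((μ (N * s) * s : ℝ) : ℂ)‖ ≤ D) → ∀ w : R3,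
      ‖𝓕⁻ (fun y : R3 => Complex.exp (Complex.I *
        ((t * dispersion σ ‖(2 * Real.pi) • y‖ : ℝ) : ℂ)) * (μ ‖(2 * Real.pi) • y‖ : ℂ)) w‖ ≤
        C * N ^ 3 * (M * min 1 (1 / |T| ^ 2) + D / |T|) := by
  obtain ⟨C, hC, H⟩ := exists_radial_integral_bound hσ ha hab
  have hpi := Real.pi_pos
  refine ⟨2 * Real.pi / (2 * Real.pi) ^ 3 * C, by positivity, ?_⟩
  intro α β hp M N t T μ hN hm hμ hT hTT D hD w
  rw [fourierInv_propagator hσ hN ha hab hμ hm.eq_zero hTT w, norm_mul]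
  have := H α β hp M _ hm T hT D hD (N * ‖w‖) (by positivity)
  have e : ‖(2 * Real.pi * (N / (2 * Real.pi) : ℝ) ^ 3 : ℂ)‖ =
      2 * Real.pi / (2 * Real.pi) ^ 3 * N ^ 3 := by
    rw [norm_mul, norm_mul, norm_pow, Complex.norm_real, Complex.norm_real, Complex.norm_ofNat,
      Real.norm_of_nonneg hpi.le, Real.norm_of_nonneg (by positivity)]
    field_simp
  rw [e]
  calc _ ≤ 2 * Real.pi / (2 * Real.pi) ^ 3 * N ^ 3 *
        (C * (M * min 1 (1 / |T| ^ 2) + D / |T|)) := by gcongr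
    _ = _ := by ring

lemma degeneratePoint_rpow {σ : ℝ} (hσ₁ : 1 < σ) (hσ₂ : σ < 2) :
    degeneratePoint σ ^ σ = (2 - σ) / (2 * (σ - 1)) := by
  have h : 0 < (2 - σ) / (2 * (σ - 1)) := div_pos (by linarith) (by linarith)
  rw [degeneratePoint, ← Real.rpow_mul h.le, one_div_mul_cancel (by linarith), Real.rpow_one]

/-- Van der Corput bound for the phases `phase`, off an exceptional interval. -/
lemma norm_integral_phase_le {σ α β a b c d μ M M' T : ℝ} (hp : PhaseParam α β)
    (ha : 0 < a) (hac : a ≤ c) (hcd : c ≤ d) (hdb : d ≤ b) (hμ : 0 < μ) {m : ℝ → ℝ}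
    (hm : IsAmplitude a b M m)
    (hl : a < c → ∀ s ∈ Set.Icc a c, μ ≤ |T| * |phase₂ σ α β s|)
    (hr : d < b → ∀ s ∈ Set.Icc d b, μ ≤ |T| * |phase₂ σ α β s|)
    (hM' : ∀ s ∈ Set.Icc c d, |m s| ≤ M') (κ : ℝ) :
    ‖∫ s in a..b, osc (fun s => T * phase σ α β s + κ * s) s * ((m s * s : ℝ) : ℂ)‖ ≤
      20 / √μ * (M * (b + 1)) * (1 + (b - a)) + M' * b * (d - c) := by
  have hM := hm.nonneg
  have hab : a ≤ b := hac.trans (hcd.trans hdb)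
  have hpos : ∀ s ∈ Set.Icc a b, 0 < s := fun s hs => ha.trans_le hs.1
  refine norm_integral_osc_mul_le_of_split hac hcd hdb hμ (M := M * (b + 1)) (M' := M' * b)
    (mul_nonneg hM (by linarith))
    (θ₁ := fun s => T * phase₁ σ α β s + κ) (θ₂ := fun s => T * phase₂ σ α β s)
    (h := fun s => m s * s) (h₁ := fun s => deriv m s * s + m s) ?_ ?_ ?_ ?_ ?_ ?_ ?_ ?_ ?_ ?_
  · intro s hs
    exact (((hasDerivAt_phase hp (hpos s hs)).const_mul T).add
      ((hasDerivAt_id s).const_mul κ)).congr_deriv (by simp)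
  · intro s hs
    exact ((hasDerivAt_phase₁ hp (hpos s hs)).const_mul T).add_const _
  · intro s hs
    exact ((hasDerivAt_phase₂ hp (hpos s hs)).continuousAt.const_mul T).continuousWithinAt
  · intro h s hs
    rw [abs_mul]
    exact hl h s hs
  · intro h s hs
    rw [abs_mul]
    exact hr h s hs
  · intro s _
    exact ((hm.hasDerivAt s).mul (hasDerivAt_id s)).congr_deriv (by simp)
  · have h1 := hm.continuous
    have h2 := hm.contDiff_deriv.continuous
    fun_prop
  · intro s hs
    rw [abs_mul, abs_of_pos (hpos s hs)]
    exact mul_le_mul (hm.bound s) (by linarith [hs.2]) (hpos s hs).le hM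
  · intro s hs
    refine (abs_add_le _ _).trans ?_
    rw [abs_mul, abs_of_pos (hpos s hs)]
    have := mul_le_mul (hm.bound_deriv s) hs.2 (hpos s hs).le hM
    linarith [hm.bound s]
  · intro s hs
    have hs0 := hpos s ⟨hac.trans hs.1, hs.2.trans hdb⟩
    rw [abs_mul, abs_of_pos hs0]
    exact mul_le_mul (hM' s hs) (hs.2.trans hdb) hs0.le ((abs_nonneg _).trans (hM' s hs))

/-- By the mean value theorem, since the derivative of `s^σ` is smallest at `a`. This makes the zero
of the second derivative at `r₀` a simple one. -/
lemma mul_abs_sub_le_abs_rpow_sub {σ a b r₀ : ℝ} (hσ : 1 < σ) (ha : 0 < a)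
    (hr : r₀ ∈ Set.Icc a b) {s : ℝ} (hs : s ∈ Set.Icc a b) :
    σ * a ^ (σ - 1) * |s - r₀| ≤ |s ^ σ - r₀ ^ σ| := by
  have d : ∀ x ∈ Set.Icc a b, HasDerivAt (fun x : ℝ => x ^ σ) (σ * x ^ (σ - 1)) x := fun x hx =>
    Real.hasDerivAt_rpow_const (.inl (ha.trans_le hx.1).ne')
  have hb : ∀ x ∈ Set.Icc a b, σ * a ^ (σ - 1) ≤ σ * x ^ (σ - 1) := fun x hx => by
    have := Real.rpow_le_rpow ha.le hx.1 (by linarith : 0 ≤ σ - 1)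
    exact mul_le_mul_of_nonneg_left this (by linarith)
  rcases le_total r₀ s with h | h
  · rw [abs_of_nonneg (sub_nonneg.2 h)]
    exact (mul_sub_le_sub_of_le_deriv d hb hr.1 h hs.2).trans (le_abs_self _)
  · rw [abs_sub_comm, abs_sub_comm (s ^ σ), abs_of_nonneg (sub_nonneg.2 h)]
    exact (mul_sub_le_sub_of_le_deriv d hb hs.1 h hr.2).trans (le_abs_self _)

/-- The quotient of the two sides increases in `r` above `r₀` and decreases below it, so the worst
cases are `r₀ ± ε`. The growth `1 + r^σ` is kept to offset the normalisation by `1 + N^σ` at high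
frequency. -/
lemma exists_le_abs_rpow_sub {σ r₀ ε : ℝ} (hσ : 1 < σ) (hε : 0 < ε) (hr : ε < r₀) :
    ∃ c : ℝ, 0 < c ∧ ∀ r, 0 < r → ε ≤ |r - r₀| → c * (1 + r ^ σ) ≤ |r ^ σ - r₀ ^ σ| := by
  have hσ0 : 0 < σ := by linarith
  have hr0 : 0 < r₀ := hε.trans hr
  set y := r₀ ^ σ with hy
  have hy0 : 0 < y := Real.rpow_pos_of_pos hr0 _
  have h1 : y < (r₀ + ε) ^ σ := Real.rpow_lt_rpow hr0.le (by linarith) hσ0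
  have h2 : (r₀ - ε) ^ σ < y := Real.rpow_lt_rpow (by linarith) (by linarith) hσ0
  set c1 := ((r₀ + ε) ^ σ - y) / (1 + (r₀ + ε) ^ σ) with hc1
  set c2 := (y - (r₀ - ε) ^ σ) / (1 + y) with hc2
  have p1 : 0 < c1 := div_pos (by linarith) (by linarith)
  have p2 : 0 < c2 := div_pos (by linarith) (by linarith)
  refine ⟨min c1 c2, lt_min p1 p2, ?_⟩
  intro r hr' hε'
  have hz : 0 < r ^ σ := Real.rpow_pos_of_pos hr' _
  rcases le_abs.1 hε' with h | h
  · have h3 : (r₀ + ε) ^ σ ≤ r ^ σ := Real.rpow_le_rpow (by linarith) (by linarith) hσ0.le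
    have h4 : c1 * (1 + (r₀ + ε) ^ σ) = (r₀ + ε) ^ σ - y := by
      rw [hc1, div_mul_cancel₀ _ (by linarith)]
    have h5 : c1 ≤ 1 := by rw [hc1, div_le_one (by linarith)]; linarith
    calc min c1 c2 * (1 + r ^ σ) ≤ c1 * (1 + r ^ σ) :=
          mul_le_mul_of_nonneg_right (min_le_left _ _) (by linarith)
      _ ≤ r ^ σ - y := by nlinarith
      _ ≤ _ := le_abs_self _
  · have h3 : r ^ σ ≤ (r₀ - ε) ^ σ := Real.rpow_le_rpow hr'.le (by linarith) hσ0.le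
    have h4 : c2 * (1 + y) = y - (r₀ - ε) ^ σ := by
      rw [hc2, div_mul_cancel₀ _ (by linarith)]
    calc min c1 c2 * (1 + r ^ σ) ≤ c2 * (1 + r ^ σ) :=
          mul_le_mul_of_nonneg_right (min_le_right _ _) (by linarith)
      _ ≤ c2 * (1 + y) := mul_le_mul_of_nonneg_left (by linarith) p2.le
      _ ≤ -(r ^ σ - y) := by linarith
      _ ≤ _ := neg_le_abs _

/-- Kernel bound near the degenerate frequency. -/
lemma exists_kernel_bound_degenerate {σ a b : ℝ} (hσ₁ : 1 < σ) (hσ₂ : σ < 2) (ha : 0 < a)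
    (hr : degeneratePoint σ ∈ Set.Icc a b) :
    ∃ C : ℝ, 0 < C ∧ ∀ (M : ℝ) (μ : ℝ → ℝ), IsAmplitude a b M μ → ∀ t : ℝ, t ≠ 0 → ∀ w : R3,
      ‖𝓕⁻ (fun y : R3 => Complex.exp (Complex.I *
        ((t * dispersion σ ‖(2 * Real.pi) • y‖ : ℝ) : ℂ)) * (μ ‖(2 * Real.pi) • y‖ : ℂ)) w‖ ≤
        C * M * |t| ^ (-(4 / 3) : ℝ) := by
  have hab : a ≤ b := hr.1.trans hr.2
  have hb : 0 < b := ha.trans_le hab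
  obtain ⟨C, hC, H⟩ := exists_kernel_bound hσ₂ ha hab
  obtain ⟨c1, hc1, H1⟩ := exists_le_abs_phase₂ (a := a) (b := b) hσ₁ hσ₂ ha hb
  set r₀ := degeneratePoint σ with hr₀
  have hpp : PhaseParam 1 1 := ⟨zero_le_one, le_rfl, zero_le_one, le_rfl, by norm_num⟩
  set c2 := c1 * (σ * a ^ (σ - 1)) with hc2
  have hc2p : 0 < c2 := by
    have := Real.rpow_pos_of_pos ha (σ - 1)
    positivity
  have hba : 0 ≤ b - a := sub_nonneg.2 hab
  set K := 20 / √c2 * (b + 1) * (1 + (b - a)) + 2 * b with hK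
  have hKp : 0 < K := by positivity
  refine ⟨C * (1 + K), by positivity, ?_⟩
  intro M μ hμ t ht w
  have hM := hμ.nonneg
  have ht' : 0 < |t| := abs_pos.2 ht
  -- This choice equates the length scale of the removed interval with the van der Corput bound
  -- `(|t| δ)^(-1/2)` outside it.
  set δ := |t| ^ (-(1 / 3) : ℝ) with hδ
  have hδ0 : 0 < δ := Real.rpow_pos_of_pos ht' _
  have h3 : |t| * c2 * δ = c2 / δ ^ 2 := by
    have : δ ^ 3 = |t|⁻¹ := by
      rw [hδ, ← Real.rpow_natCast, ← Real.rpow_mul ht'.le, ← Real.rpow_neg_one]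
      norm_num
    have e : |t| * δ ^ 3 = 1 := by rw [this, mul_inv_cancel₀ ht'.ne']
    rw [eq_div_iff (by positivity)]
    linear_combination c2 * e
  have hder : ∀ s ∈ Set.Icc a b, δ ≤ |s - r₀| → |t| * c2 * δ ≤ |t| * |phase₂ σ 1 1 s| := by
    intro s hs hsd
    rw [mul_assoc]
    apply mul_le_mul_of_nonneg_left _ ht'.le
    have e1 := H1 1 1 hpp s hs
    rw [one_mul, one_mul, one_mul, ← degeneratePoint_rpow hσ₁ hσ₂] at e1
    refine le_trans ?_ e1
    rw [hc2, mul_assoc]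
    apply mul_le_mul_of_nonneg_left _ hc1.le
    refine le_trans ?_ (mul_abs_sub_le_abs_rpow_sub hσ₁ ha hr hs)
    exact mul_le_mul_of_nonneg_left hsd (by
      have := Real.rpow_pos_of_pos ha (σ - 1)
      positivity)
  have hD : ∀ κ : ℝ, ‖∫ s in a..b, osc (fun s => t * phase σ 1 1 s + κ * s) s *
      ((μ (1 * s) * s : ℝ) : ℂ)‖ ≤ K * M * δ := by
    intro κ
    simp only [one_mul]
    -- For small `|t|` the interval around `r₀` may leave `[a, b]`; it is truncated, and the
    -- corresponding outer piece is then a single point.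
    have h1 : max a (r₀ - δ) ≤ r₀ := max_le hr.1 (by linarith)
    have h2 : r₀ ≤ min b (r₀ + δ) := le_min hr.2 (by linarith)
    refine (norm_integral_phase_le (σ := σ) (T := t) (M' := M) (μ := |t| * c2 * δ) hpp ha
      (le_max_left a (r₀ - δ)) (h1.trans h2) (min_le_left b (r₀ + δ)) (by positivity) hμ ?_ ?_
      (fun s _ => hμ.bound s) κ).trans ?_
    · intro h s hs
      apply hder s ⟨hs.1, hs.2.trans (h1.trans hr.2)⟩
      have : s ≤ r₀ - δ := by
        rcases le_max_iff.1 hs.2 with h' | h'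
        · rcases lt_max_iff.1 h with h'' | h''
          · exact absurd h'' (lt_irrefl _)
          · linarith
        · exact h'
      rw [abs_sub_comm]
      exact le_trans (by linarith) (le_abs_self _)
    · intro h s hs
      apply hder s ⟨(hr.1.trans h2).trans hs.1, hs.2⟩
      have : r₀ + δ ≤ s := by
        rcases min_le_iff.1 hs.1 with h' | h'
        · rcases min_lt_iff.1 h with h'' | h''
          · exact absurd h'' (lt_irrefl _)
          · linarith
        · exact h'
      exact le_trans (by linarith) (le_abs_self _)
    · have e1 : 20 / √(|t| * c2 * δ) = 20 / √c2 * δ := by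
        rw [h3, Real.sqrt_div hc2p.le, Real.sqrt_sq hδ0.le]
        field_simp
      have e2 : min b (r₀ + δ) - max a (r₀ - δ) ≤ 2 * δ := by
        have := min_le_right b (r₀ + δ)
        have := le_max_right a (r₀ - δ)
        linarith
      rw [e1]
      calc _ ≤ 20 / √c2 * δ * (M * (b + 1)) * (1 + (b - a)) + M * b * (2 * δ) := by gcongr
        _ = _ := by rw [hK]; ring
  refine (H 1 1 hpp M 1 t t μ one_pos (by simpa using hμ) hμ.continuous ht
    (fun s _ => by simp [dispersion, phase, phaseSq]) _ hD w).trans ?_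
  have e3 : δ / |t| = |t| ^ (-(4 / 3) : ℝ) := by
    rw [hδ, show (-(4 / 3) : ℝ) = -(1 / 3) - 1 by norm_num, Real.rpow_sub_one ht'.ne']
  have e4 := min_one_le_rpow ht' (by norm_num : (0 : ℝ) ≤ 4 / 3) (by norm_num)
  calc C * 1 ^ 3 * (M * min 1 (1 / |t| ^ 2) + K * M * δ / |t|)
      = C * (M * min 1 (1 / |t| ^ 2) + K * M * (δ / |t|)) := by ring
    _ ≤ C * (M * |t| ^ (-(4 / 3) : ℝ) + K * M * (δ / |t|)) := by gcongr
    _ = _ := by rw [e3]; ring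

/-- Kernel bound away from the degenerate frequency. -/
lemma exists_kernel_bound_nondegenerate {σ a b ε : ℝ} (hσ₁ : 1 < σ) (hσ₂ : σ < 2) (ha : 0 < a)
    (hab : a ≤ b) (hε : 0 < ε) (hr : ε < degeneratePoint σ) :
    ∃ C : ℝ, 0 < C ∧ ∀ (M N : ℝ) (μ : ℝ → ℝ), 0 < N → Continuous μ →
      IsAmplitude a b M (fun s => μ (N * s)) →
      (∀ r, |r - degeneratePoint σ| ≤ ε → μ r = 0) → ∀ t : ℝ, t ≠ 0 → ∀ w : R3,
      ‖𝓕⁻ (fun y : R3 => Complex.exp (Complex.I *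
        ((t * dispersion σ ‖(2 * Real.pi) • y‖ : ℝ) : ℂ)) * (μ ‖(2 * Real.pi) • y‖ : ℂ)) w‖ ≤
        C * M * |t| ^ (-(3 / 2) : ℝ) *
          (N ^ (3 / 2 + 3 * σ / 4) * (1 + N ^ σ) ^ (-(1 / 4) : ℝ)) := by
  have hb : 0 < b := ha.trans_le hab
  obtain ⟨C, hC, H⟩ := exists_kernel_bound hσ₂ ha hab
  obtain ⟨c1, hc1, H1⟩ := exists_le_abs_phase₂ (a := a) (b := b) hσ₁ hσ₂ ha hb
  obtain ⟨c2, hc2, H2⟩ := exists_le_abs_rpow_sub hσ₁ hε hr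
  set r₀ := degeneratePoint σ with hr₀
  -- Chosen so that `c3 * (1 + N^σ) ≤ 1 + (N s)^σ` for all `s ≥ a`.
  set c3 := min 1 (a ^ σ) with hc3
  have hc3p : 0 < c3 := lt_min one_pos (Real.rpow_pos_of_pos ha _)
  set c := c1 * (c2 * c3) with hc
  have hcp : 0 < c := by positivity
  have hba : 0 ≤ b - a := sub_nonneg.2 hab
  set K := 20 / √c * (b + 1) * (1 + (b - a)) with hK
  have hKp : 0 < K := by positivity
  refine ⟨C * (1 + K), by positivity, ?_⟩
  intro M N μ hN hμc hμ hμ0 t ht w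
  have hM := hμ.nonneg
  -- Dividing by `S` normalises the coefficients to `α + β = 1`; the size of the dispersion relation
  -- at frequency `N` goes entirely into `T = t √P`.
  set S := 1 + N ^ σ with hS
  have hNσ : 0 < N ^ σ := Real.rpow_pos_of_pos hN _
  have hS0 : 0 < S := by positivity
  have hS1 : 1 ≤ S := by linarith
  set α := N ^ σ / S with hα
  set β := 1 / S with hβ
  have hβ0 : 0 < β := by positivity
  have hpp : PhaseParam α β := by
    refine ⟨by positivity, ?_, by positivity, ?_, ?_⟩
    · rw [hα, div_le_one hS0]; linarith
    · rw [hβ, div_le_one hS0]; exact hS1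
    · rw [hα, hβ, ← add_div, hS, add_comm (N ^ σ), div_self hS0.ne']
  set P := N ^ (2 - σ) * S with hP
  have hN2 : 0 < N ^ (2 - σ) := Real.rpow_pos_of_pos hN _
  have hP0 : 0 < P := by positivity
  set T := t * √P with hT
  have hT0 : T ≠ 0 := mul_ne_zero ht (Real.sqrt_pos.2 hP0).ne'
  have hT' : 0 < |T| := abs_pos.2 hT0
  have ht' : 0 < |t| := abs_pos.2 ht
  have hdisp : ∀ s, 0 < s → t * dispersion σ (N * s) = T * phase σ α β s := by
    intro s hs
    have e1 : N ^ (2 - σ) * N ^ σ = N ^ 2 := by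
      rw [← Real.rpow_add hN, sub_add_cancel, Real.rpow_two]
    have e2 : (N * s) ^ 2 + (N * s) ^ (2 - σ) = P * phaseSq σ α β s := by
      rw [Real.mul_rpow hN.le hs.le, phaseSq, hP, hα, hβ, mul_pow, ← e1]
      field_simp
    rw [dispersion, e2, Real.sqrt_mul hP0.le, hT, phase, mul_assoc]
  have hder : ∀ s ∈ Set.Icc a b, ε ≤ |N * s - r₀| → |T| * c * β ≤ |T| * |phase₂ σ α β s| := by
    intro s hs hsd
    have hs0 : 0 < s := ha.trans_le hs.1
    rw [mul_assoc]
    apply mul_le_mul_of_nonneg_left _ hT'.le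
    refine le_trans ?_ (H1 α β hpp s hs)
    rw [← degeneratePoint_rpow hσ₁ hσ₂, ← hr₀]
    have e1 : α * s ^ σ - β * r₀ ^ σ = β * ((N * s) ^ σ - r₀ ^ σ) := by
      rw [Real.mul_rpow hN.le hs0.le, hα, hβ]; field_simp
    rw [e1, abs_mul, abs_of_pos hβ0]
    have e2 := H2 (N * s) (by positivity) hsd
    have e3 : c3 * S ≤ 1 + (N * s) ^ σ := by
      rw [Real.mul_rpow hN.le hs0.le, hS, mul_add, mul_one]
      have i1 : c3 ≤ 1 := min_le_left _ _
      have i2 : c3 ≤ s ^ σ := (min_le_right _ _).trans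
        (Real.rpow_le_rpow ha.le hs.1 (by linarith))
      have i3 := mul_le_mul_of_nonneg_right i2 hNσ.le
      linarith
    have e4 : c2 * c3 ≤ β * |(N * s) ^ σ - r₀ ^ σ| := by
      rw [hβ, one_div_mul_eq_div, le_div_iff₀ hS0]
      calc c2 * c3 * S = c2 * (c3 * S) := by ring
        _ ≤ c2 * (1 + (N * s) ^ σ) := mul_le_mul_of_nonneg_left e3 hc2.le
        _ ≤ _ := e2
    calc c * β = c1 * (β * (c2 * c3)) := by rw [hc]; ring
      _ ≤ _ := by gcongr
  have hz := IsAmplitude.eq_zero_left_right hμ.continuous hμ.eq_zero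
  have hD : ∀ κ : ℝ, ‖∫ s in a..b, osc (fun s => T * phase σ α β s + κ * s) s *
      ((μ (N * s) * s : ℝ) : ℂ)‖ ≤ K * M / √(|T| * β) := by
    intro κ
    have hle : (r₀ - ε) / N ≤ (r₀ + ε) / N := by gcongr; linarith
    -- The exceptional interval is where `|N s - r₀| ≤ ε`, clamped to `[a, b]`. The amplitude
    -- vanishes there, also when clamping leaves only an endpoint, hence `M' = 0`.
    refine (norm_integral_phase_le (σ := σ) (T := T) (M' := 0) (μ := |T| * c * β) hpp ha
      (c := max a (min b ((r₀ - ε) / N))) (d := max a (min b ((r₀ + ε) / N)))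
      (le_max_left _ _) (max_le_max le_rfl (min_le_min le_rfl hle))
      (max_le hab (min_le_left _ _)) (by positivity) hμ ?_ ?_ ?_ κ).trans ?_
    · intro h s hs
      have hs' : s ≤ min b ((r₀ - ε) / N) := by
        rcases le_max_iff.1 hs.2 with h' | h'
        · rcases lt_max_iff.1 h with h'' | h''
          · exact absurd h'' (lt_irrefl _)
          · linarith
        · exact h'
      apply hder s ⟨hs.1, hs'.trans (min_le_left _ _)⟩
      have h1 := hs'.trans (min_le_right _ _)
      rw [le_div_iff₀ hN] at h1
      rw [abs_sub_comm]
      exact le_trans (by linarith) (le_abs_self _)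
    · intro h s hs
      have h0 : min b ((r₀ + ε) / N) < b := (le_max_right _ _).trans_lt h
      have h1 : (r₀ + ε) / N ≤ s := by
        have h2 := (le_max_right _ _).trans hs.1
        rcases min_le_iff.1 h2 with h' | h'
        · rcases min_lt_iff.1 h0 with h'' | h''
          · exact absurd h'' (lt_irrefl _)
          · linarith
        · exact h'
      apply hder s ⟨(le_max_left _ _).trans hs.1, hs.2⟩
      rw [div_le_iff₀ hN] at h1
      exact le_trans (by linarith) (le_abs_self _)
    · intro s hs
      have hsa : a ≤ s := (le_max_left _ _).trans hs.1
      have hsb : s ≤ b := hs.2.trans (max_le hab (min_le_left _ _))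
      suffices μ (N * s) = 0 by simp [this]
      rcases min_le_iff.1 ((le_max_right _ _).trans hs.1) with h1 | h1
      · rw [le_antisymm hsb h1]; exact hz.2
      rcases le_max_iff.1 hs.2 with h2 | h2
      · rw [le_antisymm h2 hsa]; exact hz.1
      have h2 := h2.trans (min_le_right _ _)
      rw [div_le_iff₀ hN] at h1
      rw [le_div_iff₀ hN] at h2
      exact hμ0 _ (abs_le.2 ⟨by linarith, by linarith⟩)
    · rw [zero_mul, zero_mul, add_zero, mul_right_comm |T|, Real.sqrt_mul (by positivity), hK]
      apply le_of_eq
      field_simp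
  refine (H α β hpp M N t T _ hN hμ hμc hT0 hdisp _ hD w).trans ?_
  have f1 := min_one_le_rpow hT' (by norm_num : (0 : ℝ) ≤ 3 / 2) (by norm_num)
  have f2 : K * M / √(|T| * β) / |T| = K * M * (|T| ^ (-(3 / 2) : ℝ) * S ^ (1 / 2 : ℝ)) := by
    rw [Real.sqrt_eq_rpow, hβ, mul_one_div, Real.div_rpow hT'.le hS0.le,
      show (-(3 / 2) : ℝ) = -(1 / 2) - 1 by norm_num, Real.rpow_sub_one hT'.ne',
      Real.rpow_neg hT'.le]
    field_simp
  have f3 : 1 ≤ S ^ (1 / 2 : ℝ) := Real.one_le_rpow hS1 (by norm_num)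
  -- `N³` is the Jacobian, `|T|^(-3/2)` contributes `P^(-3/4)`, and `S^(1/2)` is the loss from the
  -- factor `β` in the second derivative.
  have f4 : N ^ 3 * (|T| ^ (-(3 / 2) : ℝ) * S ^ (1 / 2 : ℝ)) =
      |t| ^ (-(3 / 2) : ℝ) * (N ^ (3 / 2 + 3 * σ / 4) * S ^ (-(1 / 4) : ℝ)) := by
    have g1 : |T| ^ (-(3 / 2) : ℝ) = |t| ^ (-(3 / 2) : ℝ) *
        (N ^ ((2 - σ) * (-(3 / 4))) * S ^ (-(3 / 4) : ℝ)) := by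
      rw [hT, abs_mul, abs_of_nonneg (Real.sqrt_nonneg _), Real.mul_rpow ht'.le (Real.sqrt_nonneg _),
        Real.sqrt_eq_rpow, ← Real.rpow_mul hP0.le, hP, Real.mul_rpow hN2.le hS0.le,
        ← Real.rpow_mul hN.le]
      norm_num
    have g2 : N ^ (3 / 2 + 3 * σ / 4) = N ^ 3 * N ^ ((2 - σ) * (-(3 / 4))) := by
      rw [← Real.rpow_natCast N 3, ← Real.rpow_add hN]
      congr 1
      push_cast
      ring
    have g3 : S ^ (-(1 / 4) : ℝ) = S ^ (-(3 / 4) : ℝ) * S ^ (1 / 2 : ℝ) := by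
      rw [← Real.rpow_add hS0]
      norm_num
    rw [g1, g2, g3]
    ring
  have hTp : 0 < |T| ^ (-(3 / 2) : ℝ) := Real.rpow_pos_of_pos hT' _
  calc C * N ^ 3 * (M * min 1 (1 / |T| ^ 2) + K * M / √(|T| * β) / |T|)
      ≤ C * N ^ 3 * (M * (|T| ^ (-(3 / 2) : ℝ) * S ^ (1 / 2 : ℝ)) +
          K * M * (|T| ^ (-(3 / 2) : ℝ) * S ^ (1 / 2 : ℝ))) := by
        rw [f2]
        gcongr
        exact f1.trans (le_mul_of_one_le_right hTp.le f3)
    _ = C * (1 + K) * M * (N ^ 3 * (|T| ^ (-(3 / 2) : ℝ) * S ^ (1 / 2 : ℝ))) := by ring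
    _ = _ := by rw [f4]; ring

/-! ### Fourier multipliers as convolutions. -/

section Multiplier

variable {V : Type*} [NormedAddCommGroup V] [InnerProductSpace ℝ V] [FiniteDimensional ℝ V]
  [MeasurableSpace V] [BorelSpace V]

lemma continuous_fourier_of_integrable {f : V → ℂ} (hf : Integrable f) : Continuous (𝓕 f) :=
  VectorFourier.fourierIntegral_continuous Real.continuous_fourierChar
    (by exact continuous_inner) hf

/-- A Fourier multiplier is the convolution with the inverse Fourier transform of its symbol. -/
lemma fourierInv_mul_fourier_eq {m f : V → ℂ} (hm : Integrable m) (hf : Integrable f) (x : V) :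
    𝓕⁻ (fun y => m y * 𝓕 f y) x = ∫ y, f y * 𝓕⁻ m (x - y) := by
  set g : V → ℂ := fun ξ => Complex.exp (((2 * Real.pi * inner ℝ ξ x : ℝ) : ℂ) * Complex.I) * m ξ
    with hg
  have hgi : Integrable g := by
    refine hm.bdd_mul (c := 1) (by fun_prop) (.of_forall fun ξ => ?_)
    exact (Complex.norm_exp_ofReal_mul_I _).le
  -- Self-adjointness of the Fourier transform moves it from `f` to the modulated symbol `g`, whose
  -- transform at `y` is `𝓕⁻ m (x - y)`.
  have key := VectorFourier.integral_fourierIntegral_smul_eq_flip (L := innerₗ V) (μ := volume)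
    (ν := volume) Real.continuous_fourierChar (by exact continuous_inner) hf hgi
  have e1 : 𝓕⁻ (fun y => m y * 𝓕 f y) x =
      ∫ ξ, VectorFourier.fourierIntegral Real.fourierChar volume (innerₗ V) f ξ • g ξ := by
    rw [Real.fourierInv_eq']
    congr 1
    ext ξ
    simp only [hg, smul_eq_mul]
    rw [show VectorFourier.fourierIntegral Real.fourierChar volume (innerₗ V) f ξ = 𝓕 f ξ from rfl]
    ring
  rw [e1, key]
  congr 1
  ext y
  rw [smul_eq_mul, flip_innerₗ,
    show VectorFourier.fourierIntegral Real.fourierChar volume (innerₗ V) g y = 𝓕 g y from rfl,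
    Real.fourier_eq', Real.fourierInv_eq']
  congr 2
  ext ξ
  simp only [hg, smul_eq_mul, ← mul_assoc, ← Complex.exp_add]
  congr 2
  rw [inner_sub_right]
  push_cast
  ring

lemma norm_fourierInv_mul_fourier_le {m f : V → ℂ} (hm : Integrable m) (hf : Integrable f) {B : ℝ}
    (hB : ∀ w, ‖𝓕⁻ m w‖ ≤ B) (x : V) :
    ‖𝓕⁻ (fun y => m y * 𝓕 f y) x‖ ≤ B * ∫ y, ‖f y‖ := by
  rw [fourierInv_mul_fourier_eq hm hf, ← integral_const_mul]
  refine norm_integral_le_of_norm_le (hf.norm.const_mul B) (.of_forall fun y => ?_)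
  rw [norm_mul, mul_comm]
  exact mul_le_mul_of_nonneg_right (hB _) (norm_nonneg _)

lemma eLpNorm_fourierInv_mul_fourier_le {m f : V → ℂ} (hm : Integrable m) (hf : Integrable f)
    {B : ℝ} (hB : ∀ w, ‖𝓕⁻ m w‖ ≤ B) :
    eLpNorm (𝓕⁻ (fun y => m y * 𝓕 f y)) ∞ volume ≤ ENNReal.ofReal B * eLpNorm f 1 volume := by
  rw [eLpNorm_exponent_top, eLpNorm_one_eq_lintegral_enorm,
    ← ofReal_integral_norm_eq_lintegral_enorm hf,
    ← ENNReal.ofReal_mul ((norm_nonneg _).trans (hB 0))]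
  exact eLpNormEssSup_le_of_ae_bound
    (.of_forall fun x => norm_fourierInv_mul_fourier_le hm hf hB x)

variable {χ f : V → ℂ}

lemma integrable_fourierInv_of_contDiff (hχ : ContDiff ℝ ∞ χ) (hc : HasCompactSupport χ) :
    Integrable (𝓕⁻ χ) := by
  have := (𝓕⁻ (hc.toSchwartzMap hχ)).integrable (μ := volume)
  rwa [SchwartzMap.fourierInv_coe] at this

/-- Smooth compactly supported multipliers preserve integrability. -/
lemma integrable_fourierInv_mul_fourier (hχ : ContDiff ℝ ∞ χ) (hc : HasCompactSupport χ)
    (hf : Integrable f) : Integrable (𝓕⁻ (fun y => χ y * 𝓕 f y)) := by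
  have h := hf.integrable_convolution (ContinuousLinearMap.mul ℝ ℂ)
    (integrable_fourierInv_of_contDiff hχ hc)
  refine h.congr (.of_forall fun x => ?_)
  rw [fourierInv_mul_fourier_eq (hχ.continuous.integrable_of_hasCompactSupport hc) hf]
  rfl

/-- Inversion requires the transform of `χ * 𝓕 f` to be integrable; up to reflection it is `f`
convolved with a Schwartz function. -/
lemma fourier_fourierInv_mul_fourier (hχ : ContDiff ℝ ∞ χ) (hc : HasCompactSupport χ)
    (hf : Integrable f) : 𝓕 (𝓕⁻ (fun y => χ y * 𝓕 f y)) = fun y => χ y * 𝓕 f y := by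
  have hcont : Continuous fun y => χ y * 𝓕 f y :=
    hχ.continuous.mul (continuous_fourier_of_integrable hf)
  have hi : Integrable fun y => χ y * 𝓕 f y :=
    hcont.integrable_of_hasCompactSupport hc.mul_right
  have hF : Integrable (𝓕 fun y => χ y * 𝓕 f y) := by
    have := (integrable_fourierInv_mul_fourier hχ hc hf).comp_neg
    refine this.congr (.of_forall fun x => ?_)
    simp only [Real.fourierInv_eq_fourier_neg, neg_neg]
  ext v
  exact hi.fourier_fourierInv_eq hF hcont.continuousAt

lemma fourier_sub_apply {f g : V → ℂ} (hf : Integrable f) (hg : Integrable g) (w : V) :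
    𝓕 (f - g) w = 𝓕 f w - 𝓕 g w := by
  have h : ∀ {f : V → ℂ}, Integrable f → Integrable fun v =>
      Complex.exp (((-2 * Real.pi * inner ℝ v w : ℝ) : ℂ) * Complex.I) • f v := fun hf => by
    refine hf.bdd_mul (c := 1) (by fun_prop) (.of_forall fun ξ => ?_)
    exact (Complex.norm_exp_ofReal_mul_I _).le
  simp only [Real.fourier_eq', Pi.sub_apply, smul_sub]
  exact integral_sub (h hf) (h hg)

end Multiplier

/-! ### Radial profiles and localized symbols. -/

/-- A smooth radial function supported in a shell has a smooth profile. -/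
lemma exists_radial_profile {g : R3 → ℝ} (hg : ContDiff ℝ ∞ g) (hr : IsRadial g) {a b : ℝ}
    (ha : 0 < a) (h0 : ∀ ξ, ‖ξ‖ ∉ Set.Icc a b → g ξ = 0) :
    ∃ m : ℝ → ℝ, ContDiff ℝ ∞ m ∧ (∀ ξ, g ξ = m ‖ξ‖) ∧ ∀ s, s ∉ Set.Icc a b → m s = 0 := by
  set e : R3 := EuclideanSpace.single 0 1 with he
  have hn : ∀ s : ℝ, 0 ≤ s → ‖s • e‖ = s := fun s hs => by
    rw [norm_smul, he, PiLp.norm_single, norm_one, mul_one, Real.norm_of_nonneg hs]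
  have hge : ∀ s : ℝ, 0 ≤ s → s ∉ Set.Icc a b → g (s • e) = 0 := fun s hs h =>
    h0 _ (by rwa [hn s hs])
  -- The restriction of `g` to a line is even; the transition factor removes the negative half
  -- without changing values for `s ≥ a`.
  refine ⟨fun s => g (s • e) * Real.smoothTransition (s / a), ?_, ?_, ?_⟩
  · exact (hg.comp (contDiff_id.smul contDiff_const)).mul
      (Real.smoothTransition.contDiff.comp (contDiff_id.div_const a))
  · intro ξ
    rw [hr ξ (‖ξ‖ • e) (hn _ (norm_nonneg ξ)).symm]
    simp only
    by_cases h : a ≤ ‖ξ‖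
    · rw [Real.smoothTransition.one_of_one_le ((one_le_div ha).2 h), mul_one]
    · rw [hge _ (norm_nonneg ξ) fun h' => h h'.1, zero_mul]
  · intro s hs
    rcases le_total s 0 with h | h
    · simp only [Real.smoothTransition.zero_of_nonpos (div_nonpos_of_nonpos_of_nonneg h ha.le),
        mul_zero]
    · simp only [hge s h hs, zero_mul]

lemma hasCompactSupport_of_eq_zero {a b : ℝ} {m : ℝ → ℝ} (h0 : ∀ s, s ∉ Set.Icc a b → m s = 0) :
    HasCompactSupport m := HasCompactSupport.intro isCompact_Icc h0

lemma exists_isAmplitude {a b : ℝ} {m : ℝ → ℝ} (hm : ContDiff ℝ ∞ m)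
    (h0 : ∀ s, s ∉ Set.Icc a b → m s = 0) : ∃ M, IsAmplitude a b M m := by
  have hc := hasCompactSupport_of_eq_zero h0
  have h1 : ContDiff ℝ ∞ (deriv m) := (contDiff_infty_iff_deriv.1 hm).2
  have h2 : ContDiff ℝ ∞ (deriv (deriv m)) := (contDiff_infty_iff_deriv.1 h1).2
  obtain ⟨M0, H0⟩ := hc.exists_bound_of_continuous hm.continuous
  obtain ⟨M1, H1⟩ := hc.deriv.exists_bound_of_continuous h1.continuous
  obtain ⟨M2, H2⟩ := hc.deriv.deriv.exists_bound_of_continuous h2.continuous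
  refine ⟨max M0 (max M1 M2), mod_cast contDiff_infty.1 hm 2, h0, fun s => ?_, fun s => ?_,
    fun s => ?_⟩
  · exact (H0 s).trans (le_max_left _ _)
  · exact (H1 s).trans ((le_max_left _ _).trans (le_max_right _ _))
  · exact (H2 s).trans ((le_max_right _ _).trans (le_max_right _ _))

/-- Amplitudes stay bounded when multiplied with the dilations of a fixed cutoff. -/
lemma exists_isAmplitude_mul_dilation {a b a' b' : ℝ} (ha : 0 < a) {A P : ℝ → ℝ}
    (hA : ContDiff ℝ ∞ A) (hA0 : ∀ s, s ∉ Set.Icc a b → A s = 0)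
    (hP : ContDiff ℝ ∞ P) (hP0 : ∀ s, s ∉ Set.Icc a' b' → P s = 0) :
    ∃ M, ∀ N, 0 < N → IsAmplitude a b M (fun s => A s * (1 - P (N * s))) := by
  obtain ⟨E, hE⟩ := exists_isAmplitude hA hA0
  have hc := hasCompactSupport_of_eq_zero hP0
  have p1 : ContDiff ℝ ∞ (deriv P) := (contDiff_infty_iff_deriv.1 hP).2
  have p2 : ContDiff ℝ ∞ (deriv (deriv P)) := (contDiff_infty_iff_deriv.1 p1).2
  obtain ⟨D0, H0⟩ := hc.exists_bound_of_continuous hP.continuous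
  -- The weighted derivatives `s P'` and `s² P''` are invariant under dilation. On the support of
  -- `A`, where `s ≥ a`, they control the derivatives of `P (N s)` independently of `N`.
  obtain ⟨D1, H1⟩ := (hc.deriv.mul_left (f := fun s : ℝ => s)).exists_bound_of_continuous
    (continuous_id.mul p1.continuous)
  obtain ⟨D2, H2⟩ := (hc.deriv.deriv.mul_left (f := fun s : ℝ => s ^ 2)).exists_bound_of_continuous
    ((continuous_id.pow 2).mul p2.continuous)
  have q0 : 0 ≤ D0 := (norm_nonneg _).trans (H0 0)
  have q1 : 0 ≤ D1 := (norm_nonneg _).trans (H1 0)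
  have q2 : 0 ≤ D2 := (norm_nonneg _).trans (H2 0)
  have hE0 := hE.nonneg
  set L := 1 + D0 + D1 / a + D2 / a ^ 2 with hL
  have l0 : 0 ≤ D1 / a := by positivity
  have l2 : 0 ≤ D2 / a ^ 2 := by positivity
  refine ⟨4 * (E * L), ?_⟩
  intro N hN
  set W : ℝ → ℝ := fun s => 1 - P (N * s) with hW
  set W₁ : ℝ → ℝ := fun s => -(N * deriv P (N * s)) with hW₁
  set W₂ : ℝ → ℝ := fun s => -(N * (N * deriv (deriv P) (N * s))) with hW₂
  have hlin : ∀ s, HasDerivAt (fun s : ℝ => N * s) N s := fun s => by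
    simpa using (hasDerivAt_id s).const_mul N
  have dW : ∀ s, HasDerivAt W (W₁ s) s := fun s => by
    have h := ((hP.differentiable (by simp) (N * s)).hasDerivAt.comp s (hlin s)).const_sub 1
    exact h.congr_deriv (by simp only [hW₁]; ring)
  have dW₁ : ∀ s, HasDerivAt W₁ (W₂ s) s := fun s => by
    have h := (((p1.differentiable (by simp) (N * s)).hasDerivAt.comp s (hlin s)).const_mul N).neg
    exact h.congr_deriv (by simp only [hW₂]; ring)
  have bW : ∀ s, |W s| ≤ L := fun s => by
    have h1 := H0 (N * s)
    rw [Real.norm_eq_abs] at h1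
    have h2 := abs_sub (1 : ℝ) (P (N * s))
    rw [abs_one] at h2
    simp only [hW]
    linarith
  have bW₁ : ∀ s, a ≤ s → |W₁ s| ≤ L := fun s hs => by
    have h1 := H1 (N * s)
    have hs0 : 0 < s := ha.trans_le hs
    have e : W₁ s = -((N * s * deriv P (N * s)) / s) := by simp only [hW₁]; field_simp
    rw [e, abs_neg, abs_div, abs_of_pos hs0]
    have : |N * s * deriv P (N * s)| / s ≤ D1 / a := div_le_div₀ q1 h1 ha hs
    linarith
  have bW₂ : ∀ s, a ≤ s → |W₂ s| ≤ L := fun s hs => by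
    have h1 := H2 (N * s)
    have hs0 : 0 < s := ha.trans_le hs
    have e : W₂ s = -(((N * s) ^ 2 * deriv (deriv P) (N * s)) / s ^ 2) := by
      simp only [hW₂]; field_simp
    rw [e, abs_neg, abs_div, abs_of_pos (by positivity : 0 < s ^ 2)]
    have : |(N * s) ^ 2 * deriv (deriv P) (N * s)| / s ^ 2 ≤ D2 / a ^ 2 :=
      div_le_div₀ q2 h1 (by positivity) (by gcongr)
    linarith
  have hL0 : 0 ≤ L := by positivity
  have hEL : 0 ≤ E * L := by positivity
  have e1 : deriv (fun s => A s * W s) = fun s => deriv A s * W s + A s * W₁ s := by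
    ext s
    exact ((hE.hasDerivAt s).mul (dW s)).deriv
  have e2 : deriv (deriv (fun s => A s * W s)) = fun s =>
      (deriv (deriv A) s * W s + deriv A s * W₁ s) + (deriv A s * W₁ s + A s * W₂ s) := by
    rw [e1]
    ext s
    exact (((hE.hasDerivAt_deriv s).mul (dW s)).add ((hE.hasDerivAt s).mul (dW₁ s))).deriv
  have t0 : ∀ f : ℝ → ℝ, (∀ s, |f s| ≤ E) → ∀ s, |f s * W s| ≤ E * L := fun f hf s => by
    rw [abs_mul]; exact mul_le_mul (hf s) (bW s) (abs_nonneg _) hE0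
  have t1 : ∀ f w : ℝ → ℝ, (∀ s, |f s| ≤ E) → (∀ s, s ∉ Set.Icc a b → f s = 0) →
      (∀ s, a ≤ s → |w s| ≤ L) → ∀ s, |f s * w s| ≤ E * L := fun f w hf hf0 hw s => by
    by_cases hs : s ∈ Set.Icc a b
    · rw [abs_mul]; exact mul_le_mul (hf s) (hw s hs.1) (abs_nonneg _) hE0
    · simpa [hf0 s hs] using hEL
  refine ⟨?_, ?_, ?_, ?_, ?_⟩
  · exact_mod_cast contDiff_infty.1
      (hA.mul (contDiff_const.sub (hP.comp (contDiff_const.mul contDiff_id)))) 2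
  · intro s hs
    simp only [hA0 s hs, zero_mul]
  · intro s
    linarith [t0 A hE.bound s]
  · intro s
    rw [e1]
    have h1 := t0 _ hE.bound_deriv s
    have h2 := t1 _ _ hE.bound hA0 bW₁ s
    linarith [abs_add_le (deriv A s * W s) (A s * W₁ s)]
  · intro s
    rw [e2]
    have h1 := t0 _ hE.bound_deriv_deriv s
    have h2 := t1 _ _ hE.bound_deriv hE.deriv_eq_zero bW₁ s
    have h3 := t1 _ _ hE.bound hA0 bW₂ s
    refine (abs_add_le _ _).trans ?_
    linarith [abs_add_le (deriv (deriv A) s * W s) (deriv A s * W₁ s),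
      abs_add_le (deriv A s * W₁ s) (A s * W₂ s)]

lemma hasCompactSupport_comp_two_pi_smul {g : R3 → ℂ} {R : ℝ} (h : ∀ ξ, R < ‖ξ‖ → g ξ = 0) :
    HasCompactSupport fun y : R3 => g ((2 * Real.pi) • y) := by
  apply hasCompactSupport_of_norm_le R
  intro y hy
  by_contra hlt
  push Not at hlt
  apply hy
  apply h
  rw [norm_smul, Real.norm_of_nonneg (by positivity)]
  nlinarith [Real.pi_gt_three, norm_nonneg y]

lemma integrable_propagator_symbol {σ t : ℝ} (hσ : σ < 2) {μ : ℝ → ℝ} (hμ : Continuous μ) {R : ℝ}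
    (h : ∀ r, R < r → μ r = 0) :
    Integrable fun y : R3 => Complex.exp (Complex.I *
        ((t * dispersion σ ‖(2 * Real.pi) • y‖ : ℝ) : ℂ)) * (μ ‖(2 * Real.pi) • y‖ : ℂ) := by
  apply Continuous.integrable_of_hasCompactSupport
  · have := continuous_dispersion hσ
    fun_prop
  · exact (hasCompactSupport_comp_two_pi_smul (g := fun ξ => (μ ‖ξ‖ : ℂ)) (R := R)
      fun ξ hξ => by simp [h _ hξ]).mul_left

lemma contDiff_comp_two_pi_smul {g : R3 → ℝ} (hg : ContDiff ℝ ∞ g) :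
    ContDiff ℝ ∞ fun y : R3 => ((g ((2 * Real.pi) • y) : ℝ) : ℂ) :=
  Complex.ofRealCLM.contDiff.comp (hg.comp (contDiff_const_smul (2 * Real.pi)))

/-- Composed multipliers merge into one symbol only after Fourier inversion in the middle, which a
smooth compactly supported inner symbol permits. -/
lemma linearFlow_fourierMultiplier (σ t : ℝ) {g : R3 → ℝ} (hg : ContDiff ℝ ∞ g) {R : ℝ}
    (h : ∀ ξ, R < ‖ξ‖ → g ξ = 0) {f : R3 → ℂ} (hf : Integrable f) :
    linearFlow σ t (fourierMultiplier (fun ξ => (g ξ : ℂ)) f) =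
      𝓕⁻ (fun y : R3 => Complex.exp (Complex.I *
        ((t * dispersion σ ‖(2 * Real.pi) • y‖ : ℝ) : ℂ)) *
          ((g ((2 * Real.pi) • y) : ℂ) * 𝓕 f y)) := by
  rw [linearFlow, fourierMultiplier, fourierMultiplier, fourier_fourierInv_mul_fourier
    (contDiff_comp_two_pi_smul hg) (hasCompactSupport_comp_two_pi_smul (g := fun ξ => (g ξ : ℂ))
      (R := R) fun ξ hξ => by simp [h _ hξ]) hf]

/-! ### The dispersive estimates. -/

section Dispersive

variable {r₀ ε : ℝ} {Ψ ψ : R3 → ℝ}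

lemma IsShellCutoff.eq_zero_of_notMem (hΨ : IsShellCutoff r₀ ε Ψ) (ξ : R3)
    (h : ‖ξ‖ ∉ Set.Icc (r₀ - 2 * ε) (r₀ + 2 * ε)) : Ψ ξ = 0 := by
  apply hΨ.eq_zero
  by_contra hle
  obtain ⟨h1, h2⟩ := abs_le.1 (not_lt.1 hle)
  exact h ⟨by linarith, by linarith⟩

lemma IsShellCutoff.eq_zero_of_lt (hΨ : IsShellCutoff r₀ ε Ψ) (ξ : R3)
    (h : r₀ + 2 * ε < ‖ξ‖) : Ψ ξ = 0 :=
  hΨ.eq_zero_of_notMem ξ fun h' => not_lt.2 h'.2 h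

lemma IsLittlewoodPaleyCutoff.eq_zero (hψ : IsLittlewoodPaleyCutoff ψ) (ξ : R3) (h : 2 < ‖ξ‖) :
    ψ ξ = 0 :=
  image_eq_zero_of_notMem_tsupport fun h' => not_lt.2 (hψ.tsupport_subset h') h

/-- The profile of the Littlewood-Paley symbol. -/
lemma IsLittlewoodPaleyCutoff.exists_profile (hψ : IsLittlewoodPaleyCutoff ψ) :
    ∃ A : ℝ → ℝ, ContDiff ℝ ∞ A ∧ (∀ ξ, ψ ξ - ψ ((2 : ℝ) • ξ) = A ‖ξ‖) ∧
      ∀ s, s ∉ Set.Icc (1 / 2 : ℝ) 2 → A s = 0 := by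
  apply exists_radial_profile (g := fun ξ => ψ ξ - ψ ((2 : ℝ) • ξ)) _ _ (by norm_num)
  · intro ξ hξ
    have hn : ‖(2 : ℝ) • ξ‖ = 2 * ‖ξ‖ := by simp [norm_smul]
    by_cases h : ‖ξ‖ < 1 / 2
    · rw [hψ.eq_one ξ (by linarith), hψ.eq_one _ (by rw [hn]; linarith), sub_self]
    · have h2 : 2 < ‖ξ‖ := by
        by_contra h'
        exact hξ ⟨not_lt.1 h, not_lt.1 h'⟩
      rw [hψ.eq_zero ξ h2, hψ.eq_zero _ (by rw [hn]; linarith), sub_self]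
  · exact hψ.smooth.sub (hψ.smooth.comp (contDiff_const_smul 2))
  · intro ξ η h
    simp only
    rw [hψ.radial ξ η h, hψ.radial ((2 : ℝ) • ξ) ((2 : ℝ) • η) (by simp [norm_smul, h])]

/-- Dispersive estimate near the degenerate frequency. -/
lemma exists_shell_dispersive_bound {σ : ℝ} (hσ₁ : 1 < σ) (hσ₂ : σ < 2) (hε : 0 < ε)
    (hε₀ : 2 * ε < degeneratePoint σ) (hΨ : IsShellCutoff (degeneratePoint σ) ε Ψ) :
    ∃ C : ℝ, 0 < C ∧ ∀ t : ℝ, t ≠ 0 → ∀ f : R3 → ℂ, Integrable f volume →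
      eLpNorm (linearFlow σ t (shellProj Ψ f)) ∞ volume ≤
        ENNReal.ofReal (C * |t| ^ (-(4 / 3) : ℝ)) * eLpNorm f 1 volume := by
  obtain ⟨m, hm, hmΨ, hm0⟩ := exists_radial_profile hΨ.smooth hΨ.radial (by linarith)
    hΨ.eq_zero_of_notMem
  obtain ⟨M, hM⟩ := exists_isAmplitude hm hm0
  obtain ⟨C, hC, H⟩ := exists_kernel_bound_degenerate hσ₁ hσ₂
    (a := degeneratePoint σ - 2 * ε) (b := degeneratePoint σ + 2 * ε) (by linarith)
    ⟨by linarith, by linarith⟩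
  -- `M + 1` keeps the constant positive even if `M = 0`.
  refine ⟨C * (M + 1), mul_pos hC (by linarith [hM.nonneg]), ?_⟩
  intro t ht f hf
  rw [shellProj, linearFlow_fourierMultiplier σ t hΨ.smooth hΨ.eq_zero_of_lt hf]
  simp only [hmΨ, ← mul_assoc]
  refine eLpNorm_fourierInv_mul_fourier_le (integrable_propagator_symbol hσ₂ hm.continuous
    (R := degeneratePoint σ + 2 * ε) fun r hr => hm0 r fun h => not_lt.2 h.2 hr) hf
    fun w => (H M m hM t ht w).trans ?_
  gcongr
  linarith

/-- Dispersive estimate at frequency `N`, away from the degenerate frequency. -/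
lemma exists_littlewoodPaley_dispersive_bound {σ : ℝ} (hσ₁ : 1 < σ) (hσ₂ : σ < 2) (hε : 0 < ε)
    (hε₀ : 2 * ε < degeneratePoint σ) (hΨ : IsShellCutoff (degeneratePoint σ) ε Ψ)
    (hψ : IsLittlewoodPaleyCutoff ψ) :
    ∃ C : ℝ, 0 < C ∧ ∀ t : ℝ, t ≠ 0 → ∀ f : R3 → ℂ, Integrable f volume → ∀ N : ℝ, 0 < N →
      eLpNorm (linearFlow σ t (littlewoodPaley ψ N (f - shellProj Ψ f))) ∞ volume ≤
        ENNReal.ofReal (C * |t| ^ (-(3 / 2) : ℝ) *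
          (N ^ (3 / 2 + 3 * σ / 4) * (1 + N ^ σ) ^ (-(1 / 4) : ℝ))) * eLpNorm f 1 volume := by
  obtain ⟨P, hP, hPΨ, hP0⟩ := exists_radial_profile hΨ.smooth hΨ.radial (by linarith)
    hΨ.eq_zero_of_notMem
  obtain ⟨A, hA, hAψ, hA0⟩ := hψ.exists_profile
  obtain ⟨M, hM⟩ := exists_isAmplitude_mul_dilation (by norm_num) hA hA0 hP hP0
  obtain ⟨C, hC, H⟩ := exists_kernel_bound_nondegenerate hσ₁ hσ₂ (a := 1 / 2) (b := 2)
    (by norm_num) (by norm_num) hε (by linarith)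
  refine ⟨C * (M + 1), mul_pos hC (by linarith [(hM 1 one_pos).nonneg]), ?_⟩
  intro t ht f hf N hN
  set μ : ℝ → ℝ := fun r => A (N⁻¹ * r) * (1 - P r) with hμ
  have hμN : ∀ s, μ (N * s) = A s * (1 - P (N * s)) := fun s => by
    simp only [hμ]; rw [inv_mul_cancel_left₀ hN.ne']
  have hμc : Continuous μ := by
    have := hA.continuous
    have := hP.continuous
    simp only [hμ]
    fun_prop
  set g : R3 → ℝ := fun ξ => ψ (N⁻¹ • ξ) - ψ ((2 * N⁻¹) • ξ) with hg
  have hgA : ∀ ξ, g ξ = A (N⁻¹ * ‖ξ‖) := fun ξ => by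
    have := hAψ (N⁻¹ • ξ)
    rw [norm_smul, Real.norm_of_nonneg (by positivity), smul_smul] at this
    exact this
  have hgs : ContDiff ℝ ∞ g :=
    (hψ.smooth.comp (contDiff_const_smul _)).sub (hψ.smooth.comp (contDiff_const_smul _))
  have hA2 : ∀ r, 2 * N < r → A (N⁻¹ * r) = 0 := fun r hr => by
    apply hA0
    intro h
    have := h.2
    rw [inv_mul_le_iff₀ hN] at this
    linarith
  have hQ : Integrable (shellProj Ψ f) := integrable_fourierInv_mul_fourier
    (contDiff_comp_two_pi_smul hΨ.smooth) (hasCompactSupport_comp_two_pi_smul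
      (g := fun ξ => (Ψ ξ : ℂ)) (R := degeneratePoint σ + 2 * ε) fun ξ hξ => by simp [hΨ.eq_zero_of_lt ξ hξ]) hf
  -- The symbol `1 - Ψ` is not compactly supported, so inversion is applied to `Ψ` alone and
  -- linearity does the rest.
  have hFQ : ∀ y, 𝓕 (f - shellProj Ψ f) y = (1 - (Ψ ((2 * Real.pi) • y) : ℂ)) * 𝓕 f y := by
    intro y
    rw [fourier_sub_apply hf hQ, shellProj, fourierMultiplier, fourier_fourierInv_mul_fourier
      (contDiff_comp_two_pi_smul hΨ.smooth) (hasCompactSupport_comp_two_pi_smul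
      (g := fun ξ => (Ψ ξ : ℂ)) (R := degeneratePoint σ + 2 * ε) fun ξ hξ => by simp [hΨ.eq_zero_of_lt ξ hξ]) hf]
    ring
  have e : linearFlow σ t (littlewoodPaley ψ N (f - shellProj Ψ f)) =
      𝓕⁻ (fun y : R3 => (Complex.exp (Complex.I *
        ((t * dispersion σ ‖(2 * Real.pi) • y‖ : ℝ) : ℂ)) * (μ ‖(2 * Real.pi) • y‖ : ℂ)) *
          𝓕 f y) := by
    rw [littlewoodPaley, linearFlow_fourierMultiplier σ t hgs (R := 2 * N)
      (fun ξ hξ => by rw [hgA, hA2 _ hξ]) (hf.sub hQ)]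
    congr 1
    ext y
    rw [hFQ, hgA, hPΨ]
    simp only [hμ]
    push_cast
    ring
  rw [e]
  refine eLpNorm_fourierInv_mul_fourier_le (integrable_propagator_symbol hσ₂ hμc
    (R := 2 * N) fun r hr => by simp only [hμ, hA2 r hr, zero_mul]) hf fun w =>
      (H M N μ hN hμc (by simpa only [hμN] using hM N hN) ?_ t ht w).trans ?_
  · intro r hr
    have hΨ1 : P r = 1 := by
      have hr0 : 0 ≤ r := by linarith [(abs_le.1 hr).1]
      have hn : ‖(EuclideanSpace.single 0 r : R3)‖ = r := by
        rw [PiLp.norm_single, Real.norm_of_nonneg hr0]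
      have := hPΨ (EuclideanSpace.single 0 r)
      rw [hn] at this
      rw [← this]
      exact hΨ.eq_one _ (by rwa [hn])
    simp only [hμ, hΨ1, sub_self, mul_zero]
  · gcongr
    linarith

end Dispersive

theorem lemma3p3 (σ : ℝ) (hσ₁ : 1 < σ) (hσ₂ : σ < 2)
    (ε : ℝ) (hε : 0 < ε) (hε₀ : 2 * ε < degeneratePoint σ)
    (Ψ : R3 → ℝ) (hΨ : IsShellCutoff (degeneratePoint σ) ε Ψ) :
    (∃ C : ℝ, 0 < C ∧ ∀ t : ℝ, t ≠ 0 → ∀ f : R3 → ℂ, Integrable f volume →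
      eLpNorm (linearFlow σ t (shellProj Ψ f)) ∞ volume ≤
        ENNReal.ofReal (C * |t| ^ (-(4 / 3) : ℝ)) * eLpNorm f 1 volume) ∧
    ∀ ψ : R3 → ℝ, IsLittlewoodPaleyCutoff ψ →
      ∃ C : ℝ, 0 < C ∧ ∀ t : ℝ, t ≠ 0 → ∀ f : R3 → ℂ, Integrable f volume →
        ∀ N : ℝ, (∃ k : ℤ, N = (2 : ℝ) ^ k) →
          (1 ≤ N →
            eLpNorm (linearFlow σ t (littlewoodPaley ψ N (f - shellProj Ψ f))) ∞ volume ≤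
              ENNReal.ofReal (C * |t| ^ (-(3 / 2) : ℝ) * N ^ (17 / 6 : ℝ)) *
                eLpNorm f 1 volume) ∧
          (N < 1 →
            eLpNorm (linearFlow σ t (littlewoodPaley ψ N (f - shellProj Ψ f))) ∞ volume ≤
              ENNReal.ofReal (C * |t| ^ (-(3 / 2) : ℝ) * N ^ (3 / 2 + 3 * σ / 4 : ℝ)) *
                eLpNorm f 1 volume) := by
  refine ⟨exists_shell_dispersive_bound hσ₁ hσ₂ hε hε₀ hΨ, fun ψ hψ => ?_⟩
  obtain ⟨C, hC, H⟩ := exists_littlewoodPaley_dispersive_bound hσ₁ hσ₂ hε hε₀ hΨ hψ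
  refine ⟨C, hC, ?_⟩
  rintro t ht f hf N ⟨k, rfl⟩
  set N : ℝ := 2 ^ k with hNk
  have hN : 0 < N := by positivity
  have hNσ : 0 < N ^ σ := Real.rpow_pos_of_pos hN _
  have h := H t ht f hf N hN
  refine ⟨fun hN1 => h.trans ?_, fun _ => h.trans ?_⟩
  · gcongr
    -- The resulting exponent `3/2 + σ/2` is below `5/2` for `σ < 2`, hence below `17/6`.
    calc N ^ (3 / 2 + 3 * σ / 4) * (1 + N ^ σ) ^ (-(1 / 4) : ℝ)
        ≤ N ^ (3 / 2 + 3 * σ / 4) * (N ^ σ) ^ (-(1 / 4) : ℝ) := by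
          apply mul_le_mul_of_nonneg_left _ (by positivity)
          exact Real.rpow_le_rpow_of_nonpos hNσ (by linarith) (by norm_num)
      _ = N ^ (3 / 2 + σ / 2) := by
          rw [← Real.rpow_mul hN.le, ← Real.rpow_add hN]
          congr 1
          ring
      _ ≤ N ^ (17 / 6 : ℝ) := Real.rpow_le_rpow_of_exponent_le hN1 (by linarith)
  · gcongr
    apply mul_le_of_le_one_right (by positivity)
    exact Real.rpow_le_one_of_one_le_of_nonpos (by linarith) (by norm_num)
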